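/- All spaces are complex. A (concrete) operator space is a closed subspace $X\subset B(H)$, $H$ a Hilbert space; $M_n(X)$, the space of $n\times n$ matrices with entries in $X$, carries the norm of $B(H\oplus_2\dots\oplus_2 H)$ ($n$ summands), and a linear map $u$ between operator spaces has $\|u\|_{cb}=\sup_n\|I_{M_n}\otimes u\|$. Let $\mathbf R$ and $\mathbf C$ be the row and column spaces, i.e. the closed linear spans of the matrix units $(E_{1j})_j$, resp. $(E_{i1})_i$, in $B(\ell_2)$; identify both with $\ell_2$ linearly via coordinates, and view $\mathbf R\oplus\mathbf C$ as block-diagonal operators in $B(\ell_2\oplus_2\ell_2)$. For a contraction $A\in B(\ell_2)$ put $X(A)=\{\xi\oplus A\xi:\xi\in\ell_2\}\subset\mathbf R\oplus\mathbf C$. Let $\mathfrak F$ be the family of all $X(A)$, where $A\in B(\ell_2)$ is a compact contraction that is not Hilbert--Schmidt. A family $(x_i)_{i\in I}$ in an operator space $Y$ is a *normalized $C$-completely unconditional basis* of $Y$ ($C\ge 1$) if $\|x_i\|=1$ for all $i$, the closed linear span of the $x_i$ is $Y$, and for all $n$, all finitely many $a_i\in M_n$ and all scalars $|\lambda_i|\le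 1$, $\|\sum_i\lambda_i a_i\otimes x_i\|_{M_n(Y)}\le C\|\sum_i a_i\otimes x_i\|_{M_n(Y)}$. Families $(x_i)_{i\in I}$ and $(y_k)_{k\in K}$ are *$c$-equivalent up to a permutation* if there are a bijection $\pi:I\to K$ and a linear bijection $u$ from the closed span of $(x_i)$ onto that of $(y_k)$ with $u x_i=y_{\pi(i)}$ for all $i$ and $\|u\|_{cb}\|u^{-1}\|_{cb}\le c$. Let $Y$ be a closed subspace (of finite or infinite dimension) of $X(A)\in\mathfrak F$, let $H_Y=\{\xi\in\ell_2:\xi\oplus A\xi\in Y\}$ and $A|_Y=A|_{H_Y}:H_Y\to\ell_2$. A *canonical basis* of $Y$ is a family $e_k=\xi_k\oplus A\xi_k$, where $(\xi_k)$ is an orthonormal basis of $H_Y$ consisting of eigenvectors of $|A|_Y|=((A|_Y)^*A|_Y)^{1/2}$ (including eigenvectors for the eigenvalue $0$). **Theorem.** Let $X=X(A)\in\mathfrak F$ and let $Y$ be a closed subspace of $X$. Then: (1) $Y$ has a canonical basis, and every canonical basis of $Y$ is a normalized $1$-completely unconditional basis of $Y$. (2) For every $C\ge1$, any normalized $C$-completely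 unconditional basis of $Y$ is $16C^{11}$-equivalent, up to a permutation, to any canonical basis of $Y$. -/

import Mathlib

noncomputable section

namespace RowCol

/-! ### Concrete operator spaces -/

section OperatorSpaces

variable {H K : Type*} [NormedAddCommGroup H] [InnerProductSpace ℂ H]
  [NormedAddCommGroup K] [InnerProductSpace ℂ K]

/-- The operator on the Hilbert space `H ⊕₂ ⋯ ⊕₂ H` (`n` summands) given by an `n × n` matrix `v`
of operators on `H`: `(amplify v x) i = ∑ j, v i j (x j)`. -/
def amplify {n : ℕ} (v : Matrix (Fin n) (Fin n) (H →L[ℂ] H)) :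
    PiLp 2 (fun _ : Fin n => H) →L[ℂ] PiLp 2 (fun _ : Fin n => H) :=
  (PiLp.continuousLinearEquiv 2 ℂ (fun _ : Fin n => H)).symm.toContinuousLinearMap ∘L
    (ContinuousLinearMap.pi fun i => ∑ j, v i j ∘L ContinuousLinearMap.proj j) ∘L
    (PiLp.continuousLinearEquiv 2 ℂ (fun _ : Fin n => H)).toContinuousLinearMap

/-- The norm of `M_n(B(H)) = B(H ⊕₂ ⋯ ⊕₂ H)`; restricted to matrices with entries in an operator
space `X ⊆ B(H)`, it is the norm of `M_n(X)`. -/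
def matNorm {n : ℕ} (v : Matrix (Fin n) (Fin n) (H →L[ℂ] H)) : ℝ := ‖amplify v‖

/-- The elementary tensor `a ⊗ x` in `M_n ⊗ B(H) = M_n(B(H))`. -/
def tensor {n : ℕ} (a : Matrix (Fin n) (Fin n) ℂ) (x : H →L[ℂ] H) :
    Matrix (Fin n) (Fin n) (H →L[ℂ] H) :=
  a.map fun z => z • x

/-- The completely bounded norm `sup_n ‖I_{M_n} ⊗ u‖` of a linear map `u : X → Z` between operator
spaces `X ⊆ B(H)` and `Z ⊆ B(K)`, the value `∞` being allowed. -/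
def cbNorm {X : Submodule ℂ (H →L[ℂ] H)} {Z : Submodule ℂ (K →L[ℂ] K)} (u : X →ₗ[ℂ] Z) :
    ENNReal :=
  ⨆ (n : ℕ) (v : Matrix (Fin n) (Fin n) X)
    (_ : matNorm (v.map fun x => (x : H →L[ℂ] H)) ≤ 1),
    ENNReal.ofReal (matNorm (v.map fun x => (u x : K →L[ℂ] K)))

/-- The closed linear span of a family of operators. -/
def closedSpan {ι : Type*} (x : ι → (H →L[ℂ] H)) : Submodule ℂ (H →L[ℂ] H) :=
  (Submodule.span ℂ (Set.range x)).topologicalClosure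

theorem mem_closedSpan {ι : Type*} (x : ι → (H →L[ℂ] H)) (i : ι) : x i ∈ closedSpan x :=
  Submodule.le_topologicalClosure _ (Submodule.subset_span ⟨i, rfl⟩)

/-- `(x i)` is a `c`-completely unconditional basic sequence. -/
def IsCompletelyUnconditional {ι : Type*} (c : ℝ) (x : ι → (H →L[ℂ] H)) : Prop :=
  1 ≤ c ∧ ∀ (n : ℕ) (s : Finset ι) (a : ι → Matrix (Fin n) (Fin n) ℂ) (l : ι → ℂ),
    (∀ i, ‖l i‖ ≤ 1) →
      matNorm (∑ i ∈ s, l i • tensor (a i) (x i)) ≤ c * matNorm (∑ i ∈ s, tensor (a i) (x i))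

/-- `(x i)` is a normalized `c`-completely unconditional basis of the operator space `Y`. -/
structure IsNormalizedCUBasis {ι : Type*} (c : ℝ) (Y : Submodule ℂ (H →L[ℂ] H))
    (x : ι → (H →L[ℂ] H)) : Prop where
  normalized : ∀ i, ‖x i‖ = 1
  unconditional : IsCompletelyUnconditional c x
  span_eq : closedSpan x = Y

/-- The families `(x i)` and `(y i)` are `c`-equivalent: some invertible linear map `u` between
their closed linear spans satisfies `u (x i) = y i` and `‖u‖_cb ‖u⁻¹‖_cb ≤ c`. -/
def CEquivalent {ι : Type*} (c : ℝ) (x : ι → (H →L[ℂ] H)) (y : ι → (K →L[ℂ] K)) : Prop :=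
  ∃ u : closedSpan x ≃ₗ[ℂ] closedSpan y,
    (∀ i, (u ⟨x i, mem_closedSpan x i⟩ : K →L[ℂ] K) = y i) ∧
    cbNorm u.toLinearMap * cbNorm u.symm.toLinearMap ≤ ENNReal.ofReal c

/-- The families are `c`-equivalent up to a permutation, that is, after a bijection between
the index sets. -/
def CEquivalentUpToPerm {ι κ : Type*} (c : ℝ) (x : ι → (H →L[ℂ] H)) (y : κ → (K →L[ℂ] K)) :
    Prop :=
  ∃ π : ι ≃ κ, CEquivalent c x fun i => y (π i)

end OperatorSpaces

/-! ### The spaces `X(A)` -/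

/-- The Hilbert space `ℓ₂`. -/
abbrev ell2 : Type := lp (fun _ : ℕ => ℂ) 2

/-- The canonical orthonormal basis of `ℓ₂`. -/
def delta (i : ℕ) : ell2 := lp.single 2 i 1

/-- The Hilbert space `ℓ₂ ⊕₂ ℓ₂`. -/
abbrev ell2Sum : Type := WithLp 2 (ell2 × ell2)

/-- The row operator `∑ j, ξ j • E_{0j}`, i.e. `η ↦ (∑ j, ξ j * η j) • δ₀`. The row space `𝐑` is
the range of this linear map. -/
def rowOp : ell2 →L[ℂ] (ell2 →L[ℂ] ell2) :=
  (InnerProductSpace.rankOne ℂ (delta 0)).comp (starL ℂ : ell2 ≃L⋆[ℂ] ell2).toContinuousLinearMap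

/-- The column operator `∑ i, ξ i • E_{i0}`, i.e. `η ↦ η 0 • ξ`. The column space `𝐂` is the range
of this linear map. -/
def colOp : ell2 →L[ℂ] (ell2 →L[ℂ] ell2) :=
  (InnerProductSpace.rankOne ℂ (E := ell2) (F := ell2)).flip (delta 0)

/-- The block diagonal operator `S ⊕ T` on `ℓ₂ ⊕₂ ℓ₂`. -/
def opSum (S T : ell2 →L[ℂ] ell2) : ell2Sum →L[ℂ] ell2Sum :=
  (WithLp.prodContinuousLinearEquiv 2 ℂ ell2 ell2).symm.toContinuousLinearMap ∘L
    (S.prodMap T) ∘L (WithLp.prodContinuousLinearEquiv 2 ℂ ell2 ell2).toContinuousLinearMap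

/-- The identification `ξ ↦ ξ ⊕ A ξ ∈ 𝐑 ⊕ 𝐂 ⊆ B(ℓ₂ ⊕₂ ℓ₂)` of `ℓ₂` with `X(A)`. -/
def graphEmb (A : ell2 →L[ℂ] ell2) : ell2 →L[ℂ] (ell2Sum →L[ℂ] ell2Sum) where
  toFun ξ := opSum (rowOp ξ) (colOp (A ξ))
  map_add' ξ η := by
    rw [map_add, map_add, map_add]
    rfl
  map_smul' c ξ := by
    rw [map_smul, map_smul, map_smul]
    rfl
  cont := by
    have h : Continuous fun ξ => (rowOp ξ).prodMap (colOp (A ξ)) :=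
      (ContinuousLinearMap.prodMapL ℂ ell2 ell2 ell2 ell2).continuous.comp
        (rowOp.continuous.prodMk (colOp.continuous.comp A.continuous))
    unfold opSum
    fun_prop

/-- The operator space `X(A) = {ξ ⊕ A ξ : ξ ∈ ℓ₂} ⊆ 𝐑 ⊕ 𝐂 ⊆ B(ℓ₂ ⊕₂ ℓ₂)`. -/
def spaceX (A : ell2 →L[ℂ] ell2) : Submodule ℂ (ell2Sum →L[ℂ] ell2Sum) :=
  LinearMap.range (graphEmb A).toLinearMap

/-- An operator on `ℓ₂` is Hilbert-Schmidt. -/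
def IsHilbertSchmidt (A : ell2 →L[ℂ] ell2) : Prop := Summable fun i => ‖A (delta i)‖ ^ 2

/-- The class `ℭ` of compact contractions on `ℓ₂` which are not Hilbert-Schmidt; the family
`𝔉` consists of the operator spaces `X(A)` with `A ∈ ℭ`. -/
def classC : Set (ell2 →L[ℂ] ell2) :=
  {A | IsCompactOperator A ∧ ‖A‖ ≤ 1 ∧ ¬ IsHilbertSchmidt A}

/-! ### Canonical bases -/

/-- The modulus `|T| = (T* T)^{1/2}` of an operator between Hilbert spaces. -/
def modulus {E F : Type*} [NormedAddCommGroup E] [InnerProductSpace ℂ E] [CompleteSpace E]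
    [NormedAddCommGroup F] [InnerProductSpace ℂ F] [CompleteSpace F] (T : E →L[ℂ] F) :
    E →L[ℂ] E :=
  CFC.sqrt (T.adjoint ∘L T)

/-- The subspace of `ℓ₂` corresponding to a closed subspace `Y` of `X(A)`. -/
def carrier (A : ell2 →L[ℂ] ell2) (Y : ClosedSubmodule ℂ (ell2Sum →L[ℂ] ell2Sum)) :
    ClosedSubmodule ℂ ell2 :=
  Y.comap (graphEmb A)

instance completeSpace_carrier (A : ell2 →L[ℂ] ell2)
    (Y : ClosedSubmodule ℂ (ell2Sum →L[ℂ] ell2Sum)) :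
    CompleteSpace (carrier A Y).toSubmodule :=
  (carrier A Y).isClosed.completeSpace_coe

/-- The restriction `A|_Y`. -/
def restr (A : ell2 →L[ℂ] ell2) (Y : ClosedSubmodule ℂ (ell2Sum →L[ℂ] ell2Sum)) :
    (carrier A Y).toSubmodule →L[ℂ] ell2 :=
  A ∘L (carrier A Y).toSubmodule.subtypeL

/-- `(e k)` is a canonical basis of the closed subspace `Y` of `X(A)`: `e k = ξ k ⊕ A (ξ k)`, where
`(ξ k)` is an orthonormal basis, consisting of eigenvectors of `|A|_Y|`, of the subspace of `ℓ₂`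
corresponding to `Y` (kernel vectors being eigenvectors for the eigenvalue `0`). -/
def IsCanonicalBasis {κ : Type*} (A : ell2 →L[ℂ] ell2)
    (Y : ClosedSubmodule ℂ (ell2Sum →L[ℂ] ell2Sum)) (e : κ → (ell2Sum →L[ℂ] ell2Sum)) : Prop :=
  ∃ ξ : κ → (carrier A Y).toSubmodule,
    Orthonormal ℂ ξ ∧
    (Submodule.span ℂ (Set.range ξ)).topologicalClosure = ⊤ ∧
    (∀ k, ∃ s : ℝ, modulus (restr A Y) (ξ k) = (s : ℂ) • ξ k) ∧
    ∀ k, e k = graphEmb A (ξ k)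

end RowCol

end

/-! Identify `Y` with its carrier `E` and put `B = restr A Y`. A column over `Y` is an operator V
from ℓ₂ⁿ to E, and its squared norm is max(‖V‖², ‖BV‖²_HS), which is `mass`. Columns decide complete
boundedness: for a map U of E, the row half of a matrix norm involves only ‖U‖, and the column half
reduces to single columns (`matNorm_graphMatrix_map_le`). Everything thus becomes a comparison of
Hilbert–Schmidt quantities, with multiples of ‖V‖² as admissible error.

Let f be a C-unconditional basis. Choosing signs by the parallelogram law shows that f is a Riesz
basis with coordinate map S onto ℓ₂, and that, for D = diag(‖B f_i‖), the quantities ‖DSV‖²_HS and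
‖BV‖²_HS dominate each other up to powers of C and multiples of ‖V‖² (`sum_coordinates_le_mass`,
`sum_norm_sq_le_coordinates`). So B*B and S*D²S agree up to factors, modulo operators of bounded
trace.

Such a comparison passes to ordered eigenvalues: if the positive part of a difference has trace at
most D, the positive parts of the differences of ordered eigenvalues sum to at most D
(`sum_posPart_eigenvalues_sub_le`). Applied to finite sections, with ‖B f_i‖² and the eigenvalues ‖B
b_k‖² of B*B each numbered in decreasing order, this gives a matching π by rank for which each
sequence is at most C⁴ times the other plus a summable excess (`exists_equiv_sum_posPart_le`). The
factor is paid by the Hilbert–Schmidt half and the excess by ‖V‖², so f_i ↦ b_{π(i)} and its inverse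
have completely bounded norms at most 2C⁴ and 2C³, with product 4C⁷ ≤ 16C¹¹.

Canonical bases exist by the spectral theorem for the compact operator B*B. They are 1-unconditional
because a contraction diagonal in an eigenbasis increases neither ‖V‖ nor ‖BV‖_HS
(`mass_diagonal_le`). -/

section

open scoped InnerProductSpace lp ENNReal

/-! ### Min-max principles and the trace of the positive part of a difference. -/

section Eigenvalues

variable {V : Type*} [NormedAddCommGroup V] [InnerProductSpace ℂ V] [FiniteDimensional ℂ V]
  {n : ℕ} (hn : Module.finrank ℂ V = n)

namespace LinearMap.IsSymmetric

theorem re_inner_apply_self_eq_sum {T : V →ₗ[ℂ] V} (hT : T.IsSymmetric) (x : V) :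
    (⟪x, T x⟫_ℂ).re = ∑ i, hT.eigenvalues hn i * ‖⟪hT.eigenvectorBasis hn i, x⟫_ℂ‖ ^ 2 := by
  rw [← (hT.eigenvectorBasis hn).sum_inner_mul_inner, Complex.re_sum]
  refine Finset.sum_congr rfl fun i _ => ?_
  rw [← hT, apply_eigenvectorBasis, inner_smul_left, mul_left_comm, ← inner_conj_symm x,
    RCLike.conj_mul]
  simp [← Complex.ofReal_pow]

/-- Max-min half of Courant–Fischer. Eigenvalues decrease and are indexed from 0, so the
(i+1)-dimensional range of ψ contains a nonzero vector orthogonal to the i leading eigenvectors. -/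
theorem le_eigenvalues_of_injective {T : V →ₗ[ℂ] V} (hT : T.IsSymmetric) (i : Fin n) {r : ℝ}
    (ψ : (Fin (i + 1) → ℂ) →ₗ[ℂ] V) (hψ : Function.Injective ψ)
    (h : ∀ c, r * ‖ψ c‖ ^ 2 ≤ (⟪ψ c, T (ψ c)⟫_ℂ).re) : r ≤ hT.eigenvalues hn i := by
  let v := hT.eigenvectorBasis hn
  let φ : V →ₗ[ℂ] (Fin i → ℂ) :=
    LinearMap.pi fun j => (innerSL ℂ (v (j.castLE i.2.le))).toLinearMap
  have hk : LinearMap.ker (φ ∘ₗ ψ) ≠ ⊥ := LinearMap.ker_ne_bot_of_finrank_lt (by simp)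
  obtain ⟨c, hc, hc0⟩ := (Submodule.ne_bot_iff _).1 hk
  have hx0 : 0 < ‖ψ c‖ ^ 2 := by
    have : ψ c ≠ 0 := fun h0 => hc0 (hψ (by simpa using h0))
    positivity
  have hv : ∀ j < i, ⟪v j, ψ c⟫_ℂ = 0 := fun j hj => congrFun (LinearMap.mem_ker.1 hc) ⟨j, hj⟩
  refine le_of_mul_le_mul_right ((h c).trans ?_) hx0
  rw [re_inner_apply_self_eq_sum hn hT, ← v.sum_sq_norm_inner_right, Finset.mul_sum]
  refine Finset.sum_le_sum fun j _ => ?_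
  rcases lt_or_ge j i with hj | hj
  · rw [show ⟪hT.eigenvectorBasis hn j, ψ c⟫_ℂ = 0 from hv j hj]; simp
  · exact mul_le_mul_of_nonneg_right (hT.eigenvalues_antitone hn hj) (by positivity)

/-- The dual half: i linear conditions cannot exclude every nonzero vector in the span of the first
i+1 eigenvectors. -/
theorem eigenvalues_le_of_ker {T : V →ₗ[ℂ] V} (hT : T.IsSymmetric) (i : Fin n) {r : ℝ}
    (φ : V →ₗ[ℂ] (Fin i → ℂ))
    (h : ∀ x, φ x = 0 → (⟪x, T x⟫_ℂ).re ≤ r * ‖x‖ ^ 2) : hT.eigenvalues hn i ≤ r := by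
  let v := hT.eigenvectorBasis hn
  let u : Fin (i + 1) → V := fun j => v (j.castLE i.2)
  have hu : Orthonormal ℂ u := v.orthonormal.comp _ (Fin.castLE_injective _)
  let ψ : (Fin (i + 1) → ℂ) →ₗ[ℂ] V := Fintype.linearCombination ℂ u
  have hψ : Function.Injective ψ :=
    hu.linearIndependent.fintypeLinearCombination_injective
  have hk : LinearMap.ker (φ ∘ₗ ψ) ≠ ⊥ := LinearMap.ker_ne_bot_of_finrank_lt (by simp)
  obtain ⟨c, hc, hc0⟩ := (Submodule.ne_bot_iff _).1 hk
  have hx0 : 0 < ‖ψ c‖ ^ 2 := by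
    have : ψ c ≠ 0 := fun h0 => hc0 (hψ (by simpa using h0))
    positivity
  have hv : ∀ j, i < j → ⟪v j, ψ c⟫_ℂ = 0 := fun j hj => by
    simp only [ψ, Fintype.linearCombination_apply, inner_sum, inner_smul_right]
    refine Finset.sum_eq_zero fun k _ => ?_
    rw [show ⟪v j, u k⟫_ℂ = 0 from v.orthonormal.2 fun hjk => ?_, mul_zero]
    have := k.2
    rw [hjk, Fin.lt_def, Fin.val_castLE] at hj
    omega
  refine le_of_mul_le_mul_right (le_trans ?_ (h (ψ c) hc)) hx0
  rw [re_inner_apply_self_eq_sum hn hT, ← v.sum_sq_norm_inner_right, Finset.mul_sum]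
  refine Finset.sum_le_sum fun j _ => ?_
  rcases lt_or_ge i j with hj | hj
  · rw [show ⟪hT.eigenvectorBasis hn j, ψ c⟫_ℂ = 0 from hv j hj]; simp
  · exact mul_le_mul_of_nonneg_right (hT.eigenvalues_antitone hn hj) (by positivity)

theorem eigenvalues_mono {S T : V →ₗ[ℂ] V} (hS : S.IsSymmetric) (hT : T.IsSymmetric)
    (h : ∀ x, (⟪x, S x⟫_ℂ).re ≤ (⟪x, T x⟫_ℂ).re) (i : Fin n) :
    hS.eigenvalues hn i ≤ hT.eigenvalues hn i := by
  let v := hT.eigenvectorBasis hn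
  refine eigenvalues_le_of_ker hn hS i
    (LinearMap.pi fun j => (innerSL ℂ (v (j.castLE i.2.le))).toLinearMap) fun x hx => ?_
  have hv : ∀ j < i, ⟪v j, x⟫_ℂ = 0 := fun j hj => congrFun hx ⟨j, hj⟩
  refine (h x).trans ?_
  rw [re_inner_apply_self_eq_sum hn hT, ← v.sum_sq_norm_inner_right, Finset.mul_sum]
  refine Finset.sum_le_sum fun j _ => ?_
  rcases lt_or_ge j i with hj | hj
  · rw [show ⟪hT.eigenvectorBasis hn j, x⟫_ℂ = 0 from hv j hj]; simp
  · exact mul_le_mul_of_nonneg_right (hT.eigenvalues_antitone hn hj) (by positivity)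

/-- If the trace of the positive part of `S - T` is at most `D`, then so is the sum of the positive
parts of the differences of the ordered eigenvalues. -/
theorem sum_posPart_eigenvalues_sub_le {S T : V →ₗ[ℂ] V} (hS : S.IsSymmetric)
    (hT : T.IsSymmetric) {D : ℝ}
    (h : ∀ (v : OrthonormalBasis (Fin n) ℂ V) (s : Finset (Fin n)),
      ∑ a ∈ s, (⟪v a, (S - T) (v a)⟫_ℂ).re ≤ D) :
    ∑ i, max 0 (hS.eigenvalues hn i - hT.eigenvalues hn i) ≤ D := by
  have hZ : (S - T).IsSymmetric := hS.sub hT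
  let v := hZ.eigenvectorBasis hn
  let μ := hZ.eigenvalues hn
  -- P is the positive part of S - T. Since T + P dominates both S and T, its eigenvalues bound both
  -- lists, and each positive part is at most an eigenvalue of T + P minus that of T; these
  -- differences sum to the trace of P.
  let P : V →ₗ[ℂ] V :=
    ∑ a, ((max 0 (μ a) : ℝ) : ℂ) • (InnerProductSpace.rankOne ℂ (v a) (v a)).toLinearMap
  have hPx : ∀ x y, ⟪x, P y⟫_ℂ = ∑ a, ((max 0 (μ a) : ℝ) : ℂ) * (⟪v a, y⟫_ℂ * ⟪x, v a⟫_ℂ) :=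
    fun x y => by
      simp [P, LinearMap.sum_apply]
  have hP : P.IsSymmetric := fun x y => by
    rw [← inner_conj_symm, hPx, hPx, map_sum]
    refine Finset.sum_congr rfl fun a _ => ?_
    simp only [map_mul, Complex.conj_ofReal, inner_conj_symm]
    ring
  have hPre : ∀ x, (⟪x, P x⟫_ℂ).re = ∑ a, max 0 (μ a) * ‖⟪v a, x⟫_ℂ‖ ^ 2 := fun x => by
    rw [hPx, Complex.re_sum]
    refine Finset.sum_congr rfl fun a _ => ?_
    rw [← inner_conj_symm x, RCLike.mul_conj, Complex.re_ofReal_mul]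
    simp [← Complex.ofReal_pow]
  have hW : (T + P).IsSymmetric := hT.add hP
  have h1 : ∀ i, hS.eigenvalues hn i ≤ hW.eigenvalues hn i :=
    eigenvalues_mono hn hS hW fun x => by
      have : (⟪x, (S - T) x⟫_ℂ).re ≤ (⟪x, P x⟫_ℂ).re := by
        rw [re_inner_apply_self_eq_sum hn hZ, hPre]
        gcongr
        exact le_max_right _ _
      simp only [LinearMap.sub_apply, LinearMap.add_apply, inner_sub_right, inner_add_right,
        Complex.sub_re, Complex.add_re] at this ⊢
      linarith
  have h2 : ∀ i, hT.eigenvalues hn i ≤ hW.eigenvalues hn i :=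
    eigenvalues_mono hn hT hW fun x => by
      have : 0 ≤ (⟪x, P x⟫_ℂ).re := by
        rw [hPre]
        positivity
      simp only [LinearMap.add_apply, inner_add_right, Complex.add_re]
      linarith
  calc ∑ i, max 0 (hS.eigenvalues hn i - hT.eigenvalues hn i)
      ≤ ∑ i, (hW.eigenvalues hn i - hT.eigenvalues hn i) :=
        Finset.sum_le_sum fun i _ => max_le (by linarith [h2 i]) (by linarith [h1 i])
    _ = ∑ a, max 0 (μ a) := by
        rw [Finset.sum_sub_distrib, ← hW.re_trace_eq_sum_eigenvalues,
          ← hT.re_trace_eq_sum_eigenvalues, map_add, map_add, add_sub_cancel_left,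
          LinearMap.trace_eq_sum_inner _ v, map_sum]
        refine Finset.sum_congr rfl fun a _ => (hPre (v a)).trans ?_
        rw [Finset.sum_eq_single a]
        · simp
        · intro b _ hb
          rw [v.orthonormal.2 hb]
          simp
        · simp
    -- The trace of P is the partial trace of S - T over the eigenvectors with positive eigenvalue,
    -- an instance of the hypothesis.
    _ = ∑ a with 0 < μ a, (⟪v a, (S - T) (v a)⟫_ℂ).re := by
        rw [Finset.sum_filter]
        refine Finset.sum_congr rfl fun a _ => ?_
        rw [apply_eigenvectorBasis, inner_smul_right]
        split_ifs with ha
        · rw [max_eq_right ha.le]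
          simp [v, μ]
        · exact max_eq_left (not_lt.1 ha)
    _ ≤ D := h v _

end LinearMap.IsSymmetric

end Eigenvalues

namespace RowCol

/-! ### Families of vectors as operators on ℓ₂ⁿ. -/

section Synthesis

variable {E F : Type*} [NormedAddCommGroup E] [InnerProductSpace ℂ E]
  [NormedAddCommGroup F] [InnerProductSpace ℂ F] {n : ℕ}

/-- The operator `β ↦ ∑ a, β a • η a` on `ℓ₂ⁿ`. -/
noncomputable def synth (η : Fin n → E) : EuclideanSpace ℂ (Fin n) →L[ℂ] E :=
  ∑ a, (EuclideanSpace.proj a : EuclideanSpace ℂ (Fin n) →L[ℂ] ℂ).smulRight (η a)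

theorem synth_apply (η : Fin n → E) (β : EuclideanSpace ℂ (Fin n)) :
    synth η β = ∑ a, β a • η a := by
  simp [synth]

theorem continuous_synth : Continuous (synth : (Fin n → E) → _) := by
  unfold synth
  refine continuous_finsetSum _ fun a _ => ?_
  exact (ContinuousLinearMap.smulRightL ℂ (EuclideanSpace ℂ (Fin n)) E
    (EuclideanSpace.proj a)).continuous.comp (continuous_apply a)

theorem synth_comp (S : E →L[ℂ] F) (η : Fin n → E) :
    synth (fun a => S (η a)) = S ∘L synth η := by
  ext
  simp [synth_apply, map_sum]

theorem norm_synth_comp_le (S : E →L[ℂ] F) (η : Fin n → E) :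
    ‖synth (fun a => S (η a))‖ ≤ ‖S‖ * ‖synth η‖ := by
  rw [synth_comp]
  exact S.opNorm_comp_le _

theorem norm_synth_le_iff {η : Fin n → E} {K : ℝ} (hK : 0 ≤ K) :
    ‖synth η‖ ≤ K ↔ ∀ β : Fin n → ℂ, ‖∑ a, β a • η a‖ ^ 2 ≤ K ^ 2 * ∑ a, ‖β a‖ ^ 2 := by
  rw [ContinuousLinearMap.opNorm_le_iff hK]
  have key : ∀ β : EuclideanSpace ℂ (Fin n), ‖synth η β‖ ≤ K * ‖β‖ ↔
      ‖∑ a, β a • η a‖ ^ 2 ≤ K ^ 2 * ∑ a, ‖β a‖ ^ 2 := fun β => by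
    rw [← EuclideanSpace.norm_sq_eq, ← mul_pow, ← synth_apply,
      pow_le_pow_iff_left₀ (norm_nonneg _) (by positivity) two_ne_zero]
  exact ⟨fun h β => (key (WithLp.toLp 2 β)).1 (h _), fun h β => (key β).2 (h _)⟩

theorem norm_synth_le_one_of_orthogonal {η : Fin n → E} (h1 : ∀ a, ‖η a‖ ≤ 1)
    (h2 : Pairwise fun a b => ⟪η a, η b⟫_ℂ = 0) : ‖synth η‖ ≤ 1 := by
  rw [norm_synth_le_iff zero_le_one]
  intro β
  have : ‖∑ a, β a • η a‖ ^ 2 = ∑ a, ‖β a • η a‖ ^ 2 := by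
    rw [@norm_sq_eq_re_inner ℂ, sum_inner, map_sum]
    refine Finset.sum_congr rfl fun a _ => ?_
    rw [inner_sum, Finset.sum_eq_single a, ← @norm_sq_eq_re_inner ℂ]
    · intro b _ hb
      rw [inner_smul_left, inner_smul_right, h2 hb.symm]
      simp
    · simp
  rw [this, one_pow, one_mul]
  gcongr with a
  rw [norm_smul]
  exact mul_le_of_le_one_right (norm_nonneg _) (h1 a)

/-- The conjugates of the numbers c(η a) are the coordinates of the adjoint of `synth η` applied to
the vector representing c; hence the test vector β. -/
theorem sum_norm_sq_apply_le (c : E →L[ℂ] ℂ) (η : Fin n → E) :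
    ∑ a, ‖c (η a)‖ ^ 2 ≤ (‖c‖ * ‖synth η‖) ^ 2 := by
  let β : EuclideanSpace ℂ (Fin n) := WithLp.toLp 2 fun a => (starRingEnd ℂ) (c (η a))
  have h1 : c (synth η β) = ((∑ a, ‖c (η a)‖ ^ 2 : ℝ) : ℂ) := by
    simp [synth_apply, map_sum, β, Complex.conj_mul']
  have h2 : ‖β‖ ^ 2 = ∑ a, ‖c (η a)‖ ^ 2 := by
    simp [EuclideanSpace.norm_sq_eq, β]
  have h3 : ‖β‖ ^ 2 ≤ ‖c‖ * ‖synth η‖ * ‖β‖ := by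
    calc ‖β‖ ^ 2 = ‖c (synth η β)‖ := by
          rw [h1, ← h2, Complex.norm_real, Real.norm_of_nonneg (by positivity)]
      _ ≤ ‖c‖ * (‖synth η‖ * ‖β‖) :=
        (c.le_opNorm _).trans (by gcongr; exact (synth η).le_opNorm _)
      _ = _ := by ring
  rw [← h2]
  rcases (norm_nonneg β).eq_or_lt with h | h
  · rw [← h]; simp; positivity
  · gcongr
    nlinarith

/-- The eigenvalue comparison for X = diag(σ) and Y = c·B*B. Coordinate subspaces bound the
eigenvalues of X below by σ, and the j linear conditions in `hτ` bound the j-th eigenvalue of Y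
above by c·τ j. -/
theorem sum_posPart_sub_le {L : Type*} [NormedAddCommGroup L] [InnerProductSpace ℂ L]
    [CompleteSpace L] {σ τ : Fin n → ℝ} (hσ : Antitone σ) {c D : ℝ} (hc : 0 ≤ c)
    (B : EuclideanSpace ℂ (Fin n) →L[ℂ] L)
    (h : ∀ η : Fin n → EuclideanSpace ℂ (Fin n), ‖synth η‖ ≤ 1 →
      ∑ a, ∑ j, σ j * ‖η a j‖ ^ 2 ≤ D + c * ∑ a, ‖B (η a)‖ ^ 2)
    (hτ : ∀ j : Fin n, ∃ φ : EuclideanSpace ℂ (Fin n) →ₗ[ℂ] (Fin j → ℂ),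
      ∀ x, φ x = 0 → ‖B x‖ ^ 2 ≤ τ j * ‖x‖ ^ 2) :
    ∑ j, max 0 (σ j - c * τ j) ≤ D := by
  have hn : Module.finrank ℂ (EuclideanSpace ℂ (Fin n)) = n := by simp
  let e := EuclideanSpace.basisFun (Fin n) ℂ
  let X : EuclideanSpace ℂ (Fin n) →ₗ[ℂ] EuclideanSpace ℂ (Fin n) :=
    ∑ j, (σ j : ℂ) • (InnerProductSpace.rankOne ℂ (e j) (e j)).toLinearMap
  have hXx : ∀ x y, ⟪x, X y⟫_ℂ = ∑ a, (σ a : ℂ) * (⟪e a, y⟫_ℂ * ⟪x, e a⟫_ℂ) :=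
    fun x y => by
      simp [X, LinearMap.sum_apply]
  have hX : X.IsSymmetric := fun x y => by
    rw [← inner_conj_symm, hXx, hXx, map_sum]
    refine Finset.sum_congr rfl fun a _ => ?_
    simp only [map_mul, Complex.conj_ofReal, inner_conj_symm]
    ring
  have hXre : ∀ x, (⟪x, X x⟫_ℂ).re = ∑ a, σ a * ‖x a‖ ^ 2 := fun x => by
    rw [hXx, Complex.re_sum]
    refine Finset.sum_congr rfl fun a _ => ?_
    rw [← inner_conj_symm x, RCLike.mul_conj, Complex.re_ofReal_mul, ← e.repr_apply_apply]
    simp [← Complex.ofReal_pow, e]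
  let Y : EuclideanSpace ℂ (Fin n) →ₗ[ℂ] EuclideanSpace ℂ (Fin n) :=
    (c : ℂ) • (B.adjoint ∘L B).toLinearMap
  have hYx : ∀ x y, ⟪x, Y y⟫_ℂ = c * ⟪B x, B y⟫_ℂ := fun x y => by
    simp [Y, ContinuousLinearMap.adjoint_inner_right]
  have hY : Y.IsSymmetric := fun x y => by
    rw [← inner_conj_symm, hYx, hYx, map_mul, Complex.conj_ofReal, inner_conj_symm]
  have hYre : ∀ x, (⟪x, Y x⟫_ℂ).re = c * ‖B x‖ ^ 2 := fun x => by
    rw [hYx, Complex.re_ofReal_mul, ← RCLike.re_eq_complex_re, ← norm_sq_eq_re_inner]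
  have hσX : ∀ j, σ j ≤ hX.eigenvalues hn j := fun j => by
    let ψ : (Fin (j + 1) → ℂ) →ₗ[ℂ] EuclideanSpace ℂ (Fin n) :=
      { toFun d := WithLp.toLp 2 fun k => if h : k ≤ j then d ⟨k, Nat.lt_succ_of_le h⟩ else 0
        map_add' d d' := by ext k; by_cases h : k ≤ j <;> simp [h]
        map_smul' d d' := by ext k; by_cases h : k ≤ j <;> simp [h] }
    refine hX.le_eigenvalues_of_injective hn j ψ (fun d d' hd => ?_) fun d => ?_
    · ext k
      have := congrArg (fun x : EuclideanSpace ℂ (Fin n) => x (k.castLE j.2)) hd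
      have hk : k.castLE j.2 ≤ j := Nat.le_of_lt_succ k.2
      simpa [ψ, hk] using this
    · rw [hXre, EuclideanSpace.norm_sq_eq, Finset.mul_sum]
      refine Finset.sum_le_sum fun k _ => ?_
      by_cases hk : k ≤ j
      · exact mul_le_mul_of_nonneg_right (hσ hk) (by positivity)
      · simp [ψ, hk]
  have hYτ : ∀ j, hY.eigenvalues hn j ≤ c * τ j := fun j => by
    obtain ⟨φ, hφ⟩ := hτ j
    refine hY.eigenvalues_le_of_ker hn j φ fun x hx => ?_
    rw [hYre, mul_assoc]
    exact mul_le_mul_of_nonneg_left (hφ x hx) hc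
  refine le_trans (Finset.sum_le_sum fun j _ => max_le_max le_rfl
    (sub_le_sub (hσX j) (hYτ j))) (hX.sum_posPart_eigenvalues_sub_le hn hY fun v s => ?_)
  -- Replacing the vectors outside s by 0 gives a partial isometry, so `h` bounds every partial
  -- trace of X - Y.
  let η : Fin n → EuclideanSpace ℂ (Fin n) := fun a => if a ∈ s then v a else 0
  have hη : ‖synth η‖ ≤ 1 := by
    refine norm_synth_le_one_of_orthogonal (fun a => ?_) fun a b hab => ?_
    · by_cases ha : a ∈ s <;> simp [η, ha]
    · by_cases ha : a ∈ s <;> by_cases hb : b ∈ s <;> simp [η, ha, hb, v.orthonormal.2 hab]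
  have key := h η hη
  have e1 : ∑ a, ∑ j, σ j * ‖η a j‖ ^ 2 = ∑ a ∈ s, (⟪v a, X (v a)⟫_ℂ).re := by
    rw [← Finset.sum_filter_add_sum_filter_not Finset.univ (· ∈ s)]
    simp only [Finset.filter_univ_mem]
    rw [Finset.sum_congr rfl fun a ha => show _ = (⟪v a, X (v a)⟫_ℂ).re by
      rw [hXre]; simp [η, ha]]
    rw [add_eq_left]
    refine Finset.sum_eq_zero fun a ha => ?_
    simp [η, (Finset.mem_filter.1 ha).2]
  have e2 : c * ∑ a, ‖B (η a)‖ ^ 2 = ∑ a ∈ s, (⟪v a, Y (v a)⟫_ℂ).re := by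
    rw [← Finset.sum_filter_add_sum_filter_not Finset.univ (· ∈ s), mul_add]
    simp only [Finset.filter_univ_mem]
    rw [Finset.mul_sum, Finset.sum_congr rfl fun a ha => show _ = (⟪v a, Y (v a)⟫_ℂ).re by
      rw [hYre]; simp [η, ha]]
    rw [add_eq_left, Finset.sum_eq_zero, mul_zero]
    intro a ha
    simp [η, (Finset.mem_filter.1 ha).2]
  rw [e1, e2] at key
  simp only [LinearMap.sub_apply, inner_sub_right, Complex.sub_re, Finset.sum_sub_distrib]
  linarith

end Synthesis

/-! ### Choices of signs replacing averages over random signs. -/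

section Signs

variable {ι W : Type*} [NormedAddCommGroup W] [InnerProductSpace ℂ W]

/-- By the parallelogram law the two choices for each new sign average to the sum of squares, so one
of them does not exceed it. The companion lemma takes the other choice. -/
theorem exists_signs_norm_sq_le (s : Finset ι) (v : ι → W) :
    ∃ ε : ι → ℂ, (∀ i, ε i = 1 ∨ ε i = -1) ∧ ‖∑ i ∈ s, ε i • v i‖ ^ 2 ≤ ∑ i ∈ s, ‖v i‖ ^ 2 := by
  classical
  induction s using Finset.induction_on with
  | empty => exact ⟨fun _ => 1, by simp, by simp⟩
  | insert j s hj ih =>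
    obtain ⟨ε, hε, h⟩ := ih
    have key : ∃ z : ℂ, (z = 1 ∨ z = -1) ∧
        ‖z • v j + ∑ i ∈ s, ε i • v i‖ ^ 2 ≤ ‖v j‖ ^ 2 + ‖∑ i ∈ s, ε i • v i‖ ^ 2 := by
      have hp := parallelogram_law_with_norm ℂ (∑ i ∈ s, ε i • v i) (v j)
      by_cases h1 : ‖v j + ∑ i ∈ s, ε i • v i‖ ^ 2 ≤ ‖v j‖ ^ 2 + ‖∑ i ∈ s, ε i • v i‖ ^ 2
      · exact ⟨1, .inl rfl, by simpa using h1⟩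
      · refine ⟨-1, .inr rfl, ?_⟩
        rw [neg_one_smul, neg_add_eq_sub]
        rw [add_comm] at h1
        linarith
    obtain ⟨z, hz, hzle⟩ := key
    refine ⟨Function.update ε j z, fun i => ?_, ?_⟩
    · rcases eq_or_ne i j with rfl | hij
      · simpa using hz
      · simpa [hij] using hε i
    · rw [Finset.sum_insert hj, Finset.sum_insert hj, Function.update_self,
        Finset.sum_congr rfl fun i hi => show _ = ε i • v i by
          rw [Function.update_of_ne (ne_of_mem_of_not_mem hi hj)]]
      linarith

theorem exists_signs_le_norm_sq (s : Finset ι) (v : ι → W) :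
    ∃ ε : ι → ℂ, (∀ i, ε i = 1 ∨ ε i = -1) ∧ ∑ i ∈ s, ‖v i‖ ^ 2 ≤ ‖∑ i ∈ s, ε i • v i‖ ^ 2 := by
  classical
  induction s using Finset.induction_on with
  | empty => exact ⟨fun _ => 1, by simp, by simp⟩
  | insert j s hj ih =>
    obtain ⟨ε, hε, h⟩ := ih
    have key : ∃ z : ℂ, (z = 1 ∨ z = -1) ∧
        ‖v j‖ ^ 2 + ‖∑ i ∈ s, ε i • v i‖ ^ 2 ≤ ‖z • v j + ∑ i ∈ s, ε i • v i‖ ^ 2 := by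
      have hp := parallelogram_law_with_norm ℂ (∑ i ∈ s, ε i • v i) (v j)
      by_cases h1 : ‖v j‖ ^ 2 + ‖∑ i ∈ s, ε i • v i‖ ^ 2 ≤ ‖v j + ∑ i ∈ s, ε i • v i‖ ^ 2
      · exact ⟨1, .inl rfl, by simpa using h1⟩
      · refine ⟨-1, .inr rfl, ?_⟩
        rw [neg_one_smul, neg_add_eq_sub]
        rw [add_comm (v j)] at h1
        linarith
    obtain ⟨z, hz, hzle⟩ := key
    refine ⟨Function.update ε j z, fun i => ?_, ?_⟩
    · rcases eq_or_ne i j with rfl | hij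
      · simpa using hz
      · simpa [hij] using hε i
    · rw [Finset.sum_insert hj, Finset.sum_insert hj, Function.update_self,
        Finset.sum_congr rfl fun i hi => show _ = ε i • v i by
          rw [Function.update_of_ne (ne_of_mem_of_not_mem hi hj)]]
      linarith

end Signs

section LittleL2

variable {ι : Type*}

theorem hasSum_norm_sq_ell2 (y : ℓ²(ι, ℂ)) : HasSum (fun i => ‖y i‖ ^ 2) (‖y‖ ^ 2) := by
  simpa using lp.hasSum_norm (by simp) y

theorem sum_norm_sq_le_ell2 (y : ℓ²(ι, ℂ)) (s : Finset ι) : ∑ i ∈ s, ‖y i‖ ^ 2 ≤ ‖y‖ ^ 2 :=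
  sum_le_hasSum s (fun _ _ => by positivity) (hasSum_norm_sq_ell2 y)

/-- The `i`-th coordinate functional on `ℓ₂`. -/
noncomputable def coord (i : ι) : ℓ²(ι, ℂ) →L[ℂ] ℂ := lp.evalCLM ℂ (fun _ : ι => ℂ) 2 i

theorem coord_apply (i : ι) (y : ℓ²(ι, ℂ)) : coord i y = y i := rfl

theorem norm_coord_le (i : ι) : ‖coord i‖ ≤ 1 :=
  ContinuousLinearMap.opNorm_le_bound _ zero_le_one fun y => by
    rw [one_mul, coord_apply]
    exact lp.norm_apply_le_norm two_ne_zero y i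

/-- The diagonal operator with entries bounded by one. -/
noncomputable def diagOp (d : ι → ℂ) (hd : ∀ i, ‖d i‖ ≤ 1) : ℓ²(ι, ℂ) →L[ℂ] ℓ²(ι, ℂ) :=
  lp.mapCLM 2 (fun i => d i • ContinuousLinearMap.id ℂ ℂ) zero_le_one fun i => by
    rw [norm_smul]
    simpa using hd i

theorem diagOp_apply (d : ι → ℂ) (hd : ∀ i, ‖d i‖ ≤ 1) (y : ℓ²(ι, ℂ)) (i : ι) :
    diagOp d hd y i = d i * y i := by
  simp [diagOp]

theorem norm_diagOp_le (d : ι → ℂ) (hd : ∀ i, ‖d i‖ ≤ 1) : ‖diagOp d hd‖ ≤ 1 :=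
  lp.norm_mapCLM_le _ _ _ _

end LittleL2

/-! ### Consequences of unconditionality for column coefficients. -/

section Unconditional

variable {ι E L : Type*} [NormedAddCommGroup E] [InnerProductSpace ℂ E]
  [NormedAddCommGroup L] [InnerProductSpace ℂ L] {n : ℕ}

/-- The square of the norm of the column with entries `η a ⊕ B (η a)`. -/
noncomputable def mass (B : E →L[ℂ] L) (η : Fin n → E) : ℝ :=
  max (‖synth η‖ ^ 2) (∑ a, ‖B (η a)‖ ^ 2)

theorem mass_nonneg (B : E →L[ℂ] L) (η : Fin n → E) : 0 ≤ mass B η :=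
  le_max_of_le_left (by positivity)

theorem continuous_mass (B : E →L[ℂ] L) : Continuous (mass B : (Fin n → E) → ℝ) := by
  unfold mass
  refine (continuous_synth.norm.pow 2).max ?_
  fun_prop

/-- For a contraction the operator-norm half dominates on one-entry columns, so the case n = 1 of
unconditionality is unconditionality in the Hilbert norm. -/
theorem mass_single {B : E →L[ℂ] L} (hB : ‖B‖ ≤ 1) (x : E) :
    mass B (fun _ : Fin 1 => x) = ‖x‖ ^ 2 := by
  have h1 : ‖synth fun _ : Fin 1 => x‖ = ‖x‖ := by
    apply le_antisymm
    · rw [norm_synth_le_iff (norm_nonneg _)]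
      intro β
      simp [norm_smul, mul_pow, mul_comm]
    · have := (norm_synth_le_iff (n := 1) (η := fun _ => x) (norm_nonneg _)).1 le_rfl fun _ => 1
      rw [← pow_le_pow_iff_left₀ (norm_nonneg _) (norm_nonneg _) two_ne_zero]
      simpa using this
  rw [mass, h1, max_eq_left]
  simp only [Finset.univ_unique, Finset.sum_const, Finset.card_singleton, one_smul]
  gcongr
  exact B.le_of_opNorm_le_of_le hB le_rfl |>.trans (by simp)

/-- `f` is a normalized complete sequence such that the elements `f i ⊕ B (f i)` satisfy the
unconditionality inequality with constant `C` for column matrix coefficients. -/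
structure IsColumnUnconditional (C : ℝ) (B : E →L[ℂ] L) (f : ι → E) : Prop where
  one_le : 1 ≤ C
  norm_eq : ∀ i, ‖f i‖ = 1
  dense : (Submodule.span ℂ (Set.range f)).topologicalClosure = ⊤
  mass_le : ∀ (n : ℕ) (s : Finset ι) (x : Fin n → ι → ℂ) (l : ι → ℂ), (∀ i, ‖l i‖ ≤ 1) →
    mass B (fun a => ∑ i ∈ s, (l i * x a i) • f i) ≤ C ^ 2 * mass B fun a => ∑ i ∈ s, x a i • f i

theorem norm_le_one_of_sign {z : ℂ} (h : z = 1 ∨ z = -1) : ‖z‖ ≤ 1 := by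
  rcases h with rfl | rfl <;> simp

theorem sign_mul_sign {z : ℂ} (h : z = 1 ∨ z = -1) : z * z = 1 := by
  rcases h with rfl | rfl <;> simp

namespace IsColumnUnconditional

variable {C : ℝ} {B : E →L[ℂ] L} {f : ι → E}

theorem norm_map_le_one (hB : ‖B‖ ≤ 1) (hf : IsColumnUnconditional C B f) (i : ι) :
    ‖B (f i)‖ ≤ 1 :=
  B.le_of_opNorm_le_of_le hB (hf.norm_eq i).le |>.trans (by simp)

/-- Some choice of signs makes the norm large enough, and unconditionality removes the signs at cost
C. With `norm_sq_le` this makes f a Riesz basis. -/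
theorem sum_sq_le (hB : ‖B‖ ≤ 1) (hf : IsColumnUnconditional C B f) (s : Finset ι) (x : ι → ℂ) :
    ∑ i ∈ s, ‖x i‖ ^ 2 ≤ C ^ 2 * ‖∑ i ∈ s, x i • f i‖ ^ 2 := by
  obtain ⟨ε, hε, h⟩ := exists_signs_le_norm_sq s fun i => x i • f i
  have := hf.mass_le 1 s (fun _ => x) ε fun i => norm_le_one_of_sign (hε i)
  rw [mass_single hB, mass_single hB] at this
  simp only [norm_smul, hf.norm_eq, mul_one, smul_smul] at h
  exact h.trans this

theorem norm_sq_le (hB : ‖B‖ ≤ 1) (hf : IsColumnUnconditional C B f) (s : Finset ι) (x : ι → ℂ) :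
    ‖∑ i ∈ s, x i • f i‖ ^ 2 ≤ C ^ 2 * ∑ i ∈ s, ‖x i‖ ^ 2 := by
  obtain ⟨ε, hε, h⟩ := exists_signs_norm_sq_le s fun i => x i • f i
  -- The coefficients already carry the good signs; multiplying by the same signs again restores x.
  have := hf.mass_le 1 s (fun _ i => ε i * x i) ε fun i => norm_le_one_of_sign (hε i)
  rw [mass_single hB, mass_single hB] at this
  simp only [norm_smul, hf.norm_eq, mul_one, smul_smul, ← mul_assoc,
    fun i => sign_mul_sign (hε i), one_mul] at h this
  exact this.trans (by gcongr)

theorem exists_equiv_hilbertBasis [CompleteSpace E] {F : Type*} [NormedAddCommGroup F]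
    [InnerProductSpace ℂ F] [CompleteSpace F] (b : HilbertBasis ι ℂ F)
    (hB : ‖B‖ ≤ 1) (hf : IsColumnUnconditional C B f) :
    ∃ S : E ≃L[ℂ] F, (∀ i, S (f i) = b i) ∧ (∀ x, ‖S x‖ ≤ C * ‖x‖) ∧
      ∀ y, ‖S.symm y‖ ≤ C * ‖y‖ := by
  have hC : 0 ≤ C := zero_le_one.trans hf.one_le
  let e₁ : (ι →₀ ℂ) →ₗ[ℂ] E := Finsupp.linearCombination ℂ f
  let e₂ : (ι →₀ ℂ) →ₗ[ℂ] F := Finsupp.linearCombination ℂ b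
  have h₁ : DenseRange e₁ := by
    rw [DenseRange, ← LinearMap.coe_range, Submodule.dense_iff_topologicalClosure_eq_top,
      Finsupp.range_linearCombination, hf.dense]
  have h₂ : DenseRange e₂ := by
    rw [DenseRange, ← LinearMap.coe_range, Submodule.dense_iff_topologicalClosure_eq_top,
      Finsupp.range_linearCombination, b.dense_span]
  have hn : ∀ x : ι →₀ ℂ, ‖e₂ x‖ ^ 2 = ∑ i ∈ x.support, ‖x i‖ ^ 2 := fun x => by
    rw [@norm_sq_eq_re_inner ℂ, b.orthonormal.inner_finsupp_eq_sum_left, Finsupp.sum, map_sum]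
    refine Finset.sum_congr rfl fun i _ => ?_
    simp [Complex.conj_mul', ← Complex.ofReal_pow]
  let R : (ι →₀ ℂ) ≃ₗ[ℂ] (ι →₀ ℂ) := LinearEquiv.refl ℂ _
  have n₁ : ∀ x, ‖e₂ (R x)‖ ≤ C * ‖e₁ x‖ := fun x => by
    change ‖e₂ x‖ ≤ C * ‖e₁ x‖
    rw [← pow_le_pow_iff_left₀ (norm_nonneg _) (by positivity) two_ne_zero, hn, mul_pow]
    exact hf.sum_sq_le hB _ _
  have n₂ : ∀ x, ‖e₁ (R.symm x)‖ ≤ C * ‖e₂ x‖ := fun x => by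
    change ‖e₁ x‖ ≤ C * ‖e₂ x‖
    rw [← pow_le_pow_iff_left₀ (norm_nonneg _) (by positivity) two_ne_zero, mul_pow, hn]
    exact hf.norm_sq_le hB _ _
  refine ⟨R.extend e₁ e₂ h₁ ⟨C, n₁⟩ h₂ ⟨C, n₂⟩, fun i => ?_,
    LinearEquiv.norm_extend_le R e₁ e₂ C h₁ n₁ h₂ ⟨C, n₂⟩,
    LinearEquiv.norm_extend_symm_le R e₁ e₂ C h₁ ⟨C, n₁⟩ h₂ n₂⟩
  have := LinearEquiv.extend_eq R e₁ e₂ h₁ ⟨C, n₁⟩ h₂ ⟨C, n₂⟩ (Finsupp.single i 1)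
  simpa [e₁, e₂, R] using this

theorem exists_coordinates [CompleteSpace E] (hB : ‖B‖ ≤ 1)
    (hf : IsColumnUnconditional C B f) [DecidableEq ι] :
    ∃ S : E ≃L[ℂ] ℓ²(ι, ℂ), (∀ i, S (f i) = lp.single 2 i 1) ∧ (∀ x, ‖S x‖ ≤ C * ‖x‖) ∧
      ∀ y, ‖S.symm y‖ ≤ C * ‖y‖ := by
  let b : HilbertBasis ι ℂ ℓ²(ι, ℂ) := HilbertBasis.ofRepr (LinearIsometryEquiv.refl ℂ _)
  obtain ⟨S, h, hS⟩ := hf.exists_equiv_hilbertBasis b hB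
  exact ⟨S, fun i => (h i).trans (b.repr_symm_single i).symm, hS⟩

theorem summable_inner_sq [CompleteSpace E] (hf : IsColumnUnconditional C B f) (hB : ‖B‖ ≤ 1)
    (x : E) :
    Summable fun i => ‖⟪x, f i⟫_ℂ‖ ^ 2 := by
  classical
  obtain ⟨S, hS, -⟩ := hf.exists_coordinates hB
  refine (hasSum_norm_sq_ell2
    ((S.symm : ℓ²(ι, ℂ) →L[ℂ] E).adjoint x)).summable.congr fun i => ?_
  have : f i = (S.symm : ℓ²(ι, ℂ) →L[ℂ] E) (lp.single 2 i 1) := by simp [← hS]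
  rw [this, ← ContinuousLinearMap.adjoint_inner_left, lp.inner_single_right]
  simp

variable {S : E ≃L[ℂ] ℓ²(ι, ℂ)}

theorem coordinates_sum [DecidableEq ι] (hS : ∀ i, S (f i) = lp.single 2 i 1) (s : Finset ι)
    (x : ι → ℂ)
    (hx : ∀ i ∉ s, x i = 0) (j : ι) : S (∑ i ∈ s, x i • f i) j = x j := by
  simp only [map_sum, map_smul, hS, lp.coeFn_sum, lp.coeFn_smul, Finset.sum_apply, Pi.smul_apply,
    lp.single_apply, Pi.single_apply, smul_eq_mul, mul_ite, mul_one, mul_zero]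
  rw [Finset.sum_ite_eq]
  split_ifs with h
  · rfl
  · exact (hx j h).symm

/-- Reduction by density to columns of finite combinations, all supported in one common finite set.
-/
theorem induction_column (hf : IsColumnUnconditional C B f) {p : (Fin n → E) → Prop}
    (hp : IsClosed {η | p η})
    (h : ∀ (s : Finset ι) (x : Fin n → ι → ℂ), (∀ a, ∀ i ∉ s, x a i = 0) →
      p fun a => ∑ i ∈ s, x a i • f i) (η : Fin n → E) : p η := by
  classical
  have hd : Dense (Set.univ.pi fun _ : Fin n => (Submodule.span ℂ (Set.range f) : Set E)) :=
    dense_pi _ fun _ _ => Submodule.dense_iff_topologicalClosure_eq_top.2 hf.dense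
  refine hd.induction (P := p) (fun η hη => ?_) hp η
  choose l hl using fun a => Finsupp.mem_span_range_iff_exists_finsupp.1 (hη a trivial)
  let s : Finset ι := Finset.univ.biUnion fun a => (l a).support
  have hs : ∀ a, (l a).support ⊆ s := fun a =>
    Finset.subset_biUnion_of_mem (fun a => (l a).support) (Finset.mem_univ a)
  convert h s (fun a i => l a i) fun a i hi =>
    Finsupp.notMem_support_iff.1 fun h' => hi (hs a h') with a
  rw [← hl a, Finsupp.sum]
  refine Finset.sum_subset (hs a) fun i _ hi => ?_
  rw [Finsupp.notMem_support_iff.1 hi, zero_smul]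

theorem sum_norm_sq_map_sum (s : Finset ι) (x : Fin n → ι → ℂ) (B : E →L[ℂ] L) (f : ι → E) :
    let v : ι → PiLp 2 fun _ : Fin n => L := fun i => WithLp.toLp 2 fun a => x a i • B (f i)
    (∀ ε : ι → ℂ, ‖∑ i ∈ s, ε i • v i‖ ^ 2 = ∑ a, ‖B (∑ i ∈ s, (ε i * x a i) • f i)‖ ^ 2) ∧
      ∀ i, ‖v i‖ ^ 2 = ‖B (f i)‖ ^ 2 * ∑ a, ‖x a i‖ ^ 2 := by
  refine ⟨fun ε => ?_, fun i => ?_⟩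
  · rw [PiLp.norm_sq_eq_of_L2]
    simp [map_sum, mul_smul]
  · rw [PiLp.norm_sq_eq_of_L2, Finset.mul_sum]
    simp [norm_smul, mul_pow, mul_comm]

/-- The sign choice is made for the vectors (x_a(i) B f_i)_a of Lⁿ, simultaneously in all entries of
the column. This is the bound of ‖DSV‖²_HS by C² times the mass. -/
theorem sum_coordinates_le_mass [DecidableEq ι] (hf : IsColumnUnconditional C B f)
    (hS : ∀ i, S (f i) = lp.single 2 i 1) (F : Finset ι) (η : Fin n → E) :
    ∑ i ∈ F, ‖B (f i)‖ ^ 2 * ∑ a, ‖S (η a) i‖ ^ 2 ≤ C ^ 2 * mass B η := by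
  refine hf.induction_column (p := fun η =>
    ∑ i ∈ F, ‖B (f i)‖ ^ 2 * ∑ a, ‖S (η a) i‖ ^ 2 ≤ C ^ 2 * mass B η) ?_ (fun s x hx => ?_) η
  · have hm := continuous_mass (n := n) B
    refine isClosed_le ?_ (by fun_prop)
    simp only [← coord_apply]
    fun_prop
  · obtain ⟨h1, h2⟩ := sum_norm_sq_map_sum s x B f
    obtain ⟨ε, hε, h⟩ := exists_signs_le_norm_sq s
      fun i => (WithLp.toLp 2 fun a => x a i • B (f i) : PiLp 2 fun _ : Fin n => L)
    simp only [h1, h2] at h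
    simp only [fun a i => coordinates_sum hS s (x a) (hx a) i]
    calc ∑ i ∈ F, ‖B (f i)‖ ^ 2 * ∑ a, ‖x a i‖ ^ 2
        ≤ ∑ i ∈ F ∪ s, ‖B (f i)‖ ^ 2 * ∑ a, ‖x a i‖ ^ 2 :=
          Finset.sum_le_sum_of_subset_of_nonneg Finset.subset_union_left
            fun _ _ _ => by positivity
      _ = ∑ i ∈ s, ‖B (f i)‖ ^ 2 * ∑ a, ‖x a i‖ ^ 2 :=
          (Finset.sum_subset Finset.subset_union_right fun i _ hi => by simp [hx _ i hi]).symm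
      _ ≤ mass B fun a => ∑ i ∈ s, (ε i * x a i) • f i := h.trans (le_max_right _ _)
      _ ≤ _ := hf.mass_le n s x ε fun i => norm_le_one_of_sign (hε i)

/-- The opposite bound. Signs making the Hilbert–Schmidt half small are inserted and removed at cost
C²; the operator-norm half of the signed column must then be estimated as well. -/
theorem sum_norm_sq_le_coordinates [DecidableEq ι] (hf : IsColumnUnconditional C B f)
    (hS : ∀ i, S (f i) = lp.single 2 i 1) (hS' : ∀ y, ‖S.symm y‖ ≤ C * ‖y‖) {d : ι → ℂ}
    (hd : ∀ i, ‖d i‖ ≤ 1) (hdB : ∀ i, ‖d i‖ = ‖B (f i)‖) (η : Fin n → E) :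
    ∑ a, ‖B (η a)‖ ^ 2 ≤ C ^ 2 * max ((C * ‖synth fun a => S (η a)‖) ^ 2)
      (∑ a, ‖diagOp d hd (S (η a))‖ ^ 2) := by
  have hC : 0 ≤ C := zero_le_one.trans hf.one_le
  refine hf.induction_column (p := fun η =>
    ∑ a, ‖B (η a)‖ ^ 2 ≤ C ^ 2 * max ((C * ‖synth fun a => S (η a)‖) ^ 2)
      (∑ a, ‖diagOp d hd (S (η a))‖ ^ 2)) ?_ (fun s x hx => ?_) η
  · have h1 : Continuous fun η : Fin n → E => ‖synth fun a => S (η a)‖ :=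
      (continuous_synth.comp (by fun_prop)).norm
    exact isClosed_le (by fun_prop) (by fun_prop)
  · obtain ⟨h1, h2⟩ := sum_norm_sq_map_sum s x B f
    obtain ⟨ε, hε, h⟩ := exists_signs_norm_sq_le s
      fun i => (WithLp.toLp 2 fun a => x a i • B (f i) : PiLp 2 fun _ : Fin n => L)
    simp only [h1, h2] at h
    have hε1 := fun i => norm_le_one_of_sign (hε i)
    have key := hf.mass_le n s (fun a i => ε i * x a i) ε hε1
    simp only [← mul_assoc, fun i => sign_mul_sign (hε i), one_mul] at key
    refine (le_max_right _ _).trans (key.trans ?_)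
    gcongr
    refine max_le_max ?_ (h.trans ?_)
    · gcongr
      -- Changing signs is S⁻¹ ∘ diag(ε) ∘ S. Keeping S η on the right-hand side means that only the
      -- factor C of S⁻¹ is lost.
      have e : (fun a => ∑ i ∈ s, (ε i * x a i) • f i) =
          fun a => ((S.symm : ℓ²(ι, ℂ) →L[ℂ] E) ∘L diagOp ε hε1)
            (S (∑ i ∈ s, x a i • f i)) := by
        funext a
        rw [ContinuousLinearMap.comp_apply, ContinuousLinearEquiv.coe_coe,
          ContinuousLinearEquiv.eq_symm_apply]
        ext i
        rw [diagOp_apply, coordinates_sum hS s (x a) (hx a), coordinates_sum hS s _ fun i hi => by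
          rw [hx a i hi, mul_zero]]
      rw [e]
      refine (norm_synth_comp_le _ _).trans ?_
      gcongr
      refine ContinuousLinearMap.opNorm_le_bound _ hC fun y => (hS' _).trans ?_
      gcongr
      exact (diagOp ε hε1).le_of_opNorm_le (norm_diagOp_le _ _) y |>.trans (by simp)
    · simp only [Finset.mul_sum]
      rw [Finset.sum_comm]
      refine Finset.sum_le_sum fun a _ => le_trans (Finset.sum_le_sum fun i _ => ?_)
        (sum_norm_sq_le_ell2 _ s)
      rw [diagOp_apply, coordinates_sum hS s (x a) (hx a), norm_mul, hdB, mul_pow]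

end IsColumnUnconditional

end Unconditional

/-! ### Numbering a null family of positive numbers in decreasing order. -/

section Rank

/-- The rank counts predecessors, ties being broken by an injection into ℕ. Positivity together with
finiteness above each level makes every set of predecessors finite. -/
theorem exists_rank {ι : Type*} [Countable ι] {φ : ι → ℝ} (h0 : ∀ i, 0 < φ i)
    (hφ : ∀ ε > 0, {i | ε ≤ φ i}.Finite) :
    ∃ r : ι → ℕ, Function.Injective r ∧ IsLowerSet (Set.range r) ∧
      ∀ i j, r i ≤ r j → φ j ≤ φ i := by
  obtain ⟨e, he⟩ := exists_injective_nat ι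
  let P : ι → Set ι := fun i => {j | φ i < φ j ∨ φ j = φ i ∧ e j < e i}
  have hfin : ∀ i, (P i).Finite := fun i => (hφ (φ i) (h0 i)).subset fun j hj =>
    hj.elim le_of_lt fun h => h.1.ge
  have hirr : ∀ i, i ∉ P i := fun i hi => hi.elim (lt_irrefl _) fun h => lt_irrefl _ h.2
  have htrans : ∀ i j k, j ∈ P i → k ∈ P j → k ∈ P i := fun i j k hj hk => by
    simp only [P, Set.mem_ofPred_eq] at hj hk ⊢
    rcases hj with hj | hj <;> rcases hk with hk | hk
    · exact .inl (hj.trans hk)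
    · exact .inl (hk.1 ▸ hj)
    · exact .inl (hj.1 ▸ hk)
    · exact .inr ⟨hk.1.trans hj.1, hk.2.trans hj.2⟩
  have htot : ∀ i j, i ≠ j → j ∈ P i ∨ i ∈ P j := fun i j hij => by
    simp only [P, Set.mem_ofPred_eq]
    have := he.ne hij
    grind
  have hlt : ∀ i j, j ∈ P i → (P j).ncard < (P i).ncard := fun i j hj =>
    Set.ncard_lt_ncard ⟨fun k hk => htrans i j k hj hk, fun h => hirr j (h hj)⟩ (hfin i)
  refine ⟨fun i => (P i).ncard, fun i j hij => ?_, ?_, fun i j hij => ?_⟩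
  · by_contra hne
    rcases htot i j hne with h | h
    · exact (hlt i j h).ne' hij
    · exact (hlt j i h).ne hij
  · rintro _ m hm ⟨i, rfl⟩
    obtain ⟨N, hN⟩ : ∃ N, (P i).ncard = N := ⟨_, rfl⟩
    dsimp only at hm
    induction N using Nat.strong_induction_on generalizing i with
    | _ N ih =>
      rcases hm.eq_or_lt with rfl | hm
      · exact ⟨i, rfl⟩
      · have hne : (P i).Nonempty := Set.nonempty_of_ncard_ne_zero (by omega)
        -- A predecessor of maximal rank is the immediate one, so passing to it skips no rank.
        obtain ⟨j, hj, hmax⟩ := (hfin i).exists_maximalFor (fun j => (P j).ncard) _ hne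
        refine ih _ (hN ▸ hlt i j hj) j ?_ rfl
        have hsub : P i ⊆ insert j (P j) := fun k hk => by
          rcases eq_or_ne k j with rfl | hkj
          · exact Set.mem_insert _ _
          · refine Set.mem_insert_of_mem _ ((htot j k hkj.symm).resolve_right fun h => ?_)
            exact (hlt k j h).not_ge (hmax hk (hlt k j h).le)
        have := (Set.ncard_le_ncard hsub ((hfin j).insert j)).trans (Set.ncard_insert_le _ _)
        omega
  · by_contra hlt'
    exact (hlt i j (.inl (not_le.1 hlt'))).not_ge hij

theorem IsLowerSet.eq_univ_of_infinite {s : Set ℕ} (h : IsLowerSet s) (hs : s.Infinite) :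
    s = Set.univ :=
  Set.eq_univ_of_forall fun m =>
    let ⟨_, hk, hmk⟩ := hs.exists_gt m
    h hmk.le hk

/-- Lower sets of ℕ are initial segments, hence determined by their cardinality. -/
theorem exists_equiv_rank_eq {ι κ : Type*} (e : ι ≃ κ) {r : ι → ℕ} {r' : κ → ℕ}
    (hr : Function.Injective r) (hr' : Function.Injective r') (hl : IsLowerSet (Set.range r))
    (hl' : IsLowerSet (Set.range r')) : ∃ π : ι ≃ κ, ∀ i, r' (π i) = r i := by
  have hrange : Set.range r = Set.range r' := by
    rcases finite_or_infinite ι with hfin | hinf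
    · have : Finite κ := Finite.of_equiv ι e
      have hcard : (Set.range r).ncard = (Set.range r').ncard := by
        rw [← Set.image_univ, ← Set.image_univ, Set.ncard_image_of_injective _ hr,
          Set.ncard_image_of_injective _ hr', Set.ncard_univ, Set.ncard_univ, Nat.card_congr e]
      rcases hl.total hl' with h | h
      · exact Set.eq_of_subset_of_ncard_le h hcard.ge (Set.finite_range r')
      · exact (Set.eq_of_subset_of_ncard_le h hcard.le (Set.finite_range r)).symm
    · have : Infinite κ := Infinite.of_injective e e.injective
      rw [IsLowerSet.eq_univ_of_infinite hl (Set.infinite_range_of_injective hr),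
        IsLowerSet.eq_univ_of_infinite hl' (Set.infinite_range_of_injective hr')]
  refine ⟨(Equiv.ofInjective r hr).trans
    ((Equiv.setCongr hrange).trans (Equiv.ofInjective r' hr').symm), fun i => ?_⟩
  exact congrArg Subtype.val ((Equiv.ofInjective r' hr').apply_symm_apply _)

end Rank

/-! ### Compactness and cardinality of bases. -/

section Compact

variable {ι κ E L : Type*} [NormedAddCommGroup E] [InnerProductSpace ℂ E]
  [NormedAddCommGroup L] [InnerProductSpace ℂ L]

/-- Summability makes f weakly null, and a compact operator sends it to a norm-null family. -/
theorem finite_le_norm_of_isCompactOperator [CompleteSpace E] [CompleteSpace L] {B : E →L[ℂ] L}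
    (hB : IsCompactOperator B)
    {f : ι → E} (hf : ∀ i, ‖f i‖ = 1) (hs : ∀ x, Summable fun i => ‖⟪x, f i⟫_ℂ‖ ^ 2) {ε : ℝ}
    (hε : 0 < ε) : {i | ε ≤ ‖B (f i)‖}.Finite := by
  have hK := (hB.isCompact_closure_image_closedBall 1).totallyBounded
  obtain ⟨t, ht, hcover⟩ := Metric.totallyBounded_iff.1 hK (ε / 2) (by positivity)
  -- If ‖Bf_i - y‖ < ε/2 and ‖Bf_i‖ ≥ ε, expanding the square gives 2 Re⟨y, Bf_i⟩ ≥ ε² - ε²/4; hence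
  -- the threshold 3ε²/8.
  have hfin : ∀ y ∈ t, {i | 3 * ε ^ 2 / 8 ≤ ‖⟪B.adjoint y, f i⟫_ℂ‖}.Finite := fun y _ => by
    have h0 := (hs (B.adjoint y)).tendsto_cofinite_zero
    have := h0.eventually (gt_mem_nhds (show (0 : ℝ) < (3 * ε ^ 2 / 8) ^ 2 by positivity))
    rw [Filter.eventually_cofinite] at this
    refine this.subset fun i hi => not_lt.2 ?_
    have hi' : 3 * ε ^ 2 / 8 ≤ ‖⟪B.adjoint y, f i⟫_ℂ‖ := hi
    gcongr
  refine (ht.biUnion hfin).subset fun i hi => ?_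
  have hmem : B (f i) ∈ closure (B '' Metric.closedBall 0 1) :=
    subset_closure ⟨f i, by simp [hf i], rfl⟩
  obtain ⟨y, hy, hd⟩ := Set.mem_iUnion₂.1 (hcover hmem)
  refine Set.mem_iUnion₂.2 ⟨y, hy, ?_⟩
  rw [Metric.mem_ball, dist_eq_norm] at hd
  have hi' : ε ≤ ‖B (f i)‖ := hi
  have h1 := @norm_sub_sq ℂ _ _ _ _ (y) (B (f i))
  rw [norm_sub_rev] at h1
  have h2 : RCLike.re ⟪y, B (f i)⟫_ℂ ≤ ‖⟪y, B (f i)⟫_ℂ‖ := RCLike.re_le_norm _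
  rw [Set.mem_ofPred_eq, ContinuousLinearMap.adjoint_inner_left]
  have h3 : ‖B (f i) - y‖ ^ 2 ≤ (ε / 2) ^ 2 := by gcongr
  have h4 : ε ^ 2 ≤ ‖B (f i)‖ ^ 2 := by gcongr
  nlinarith [sq_nonneg ‖y‖]

/-- Every f_i has a nonzero inner product with some d_n, and each d_n sees only countably many f_i.
-/
theorem countable_of_summable {f : ι → E} (hf : ∀ i, f i ≠ 0)
    (hs : ∀ x, Summable fun i => ‖⟪x, f i⟫_ℂ‖ ^ 2) {d : ℕ → E}
    (hd : ∀ x, (∀ n, ⟪d n, x⟫_ℂ = 0) → x = 0) : Countable ι := by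
  have h : (Set.univ : Set ι) ⊆ ⋃ n, Function.support fun i => ‖⟪d n, f i⟫_ℂ‖ ^ 2 := fun i _ => by
    by_contra hi
    refine hf i (hd _ fun n => ?_)
    simpa using fun h' => hi (Set.mem_iUnion.2 ⟨n, h'⟩)
  exact Set.countable_univ_iff.1
    ((Set.countable_iUnion fun n => (hs (d n)).countable_support).mono h)

theorem nonempty_equiv_of_finite {F : Type*} [NormedAddCommGroup F] [InnerProductSpace ℂ F]
    [Finite ι] (b : HilbertBasis ι ℂ E) (b' : HilbertBasis κ ℂ F) (S : E ≃L[ℂ] F) :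
    Nonempty (ι ≃ κ) := by
  have := Fintype.ofFinite ι
  let c : Module.Basis ι ℂ F := b.toOrthonormalBasis.toBasis.map S.toLinearEquiv
  have : FiniteDimensional ℂ F := c.finiteDimensional_of_finite
  have : Finite κ := b'.orthonormal.linearIndependent.finite
  have := Fintype.ofFinite κ
  exact ⟨c.indexEquiv b'.toOrthonormalBasis.toBasis⟩

theorem nonempty_equiv_of_hilbertBasis {F : Type*} [NormedAddCommGroup F]
    [InnerProductSpace ℂ F] [Countable ι] [Countable κ]
    (b : HilbertBasis ι ℂ E) (b' : HilbertBasis κ ℂ F) (S : E ≃L[ℂ] F) : Nonempty (ι ≃ κ) := by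
  rcases finite_or_infinite ι with hι | hι
  · exact nonempty_equiv_of_finite b b' S
  · rcases finite_or_infinite κ with hκ | hκ
    · exact (nonempty_equiv_of_finite b' b S.symm).map Equiv.symm
    · exact nonempty_equiv_of_countable

end Compact

/-! ### Comparison of sequences matched by rank. -/

section Matching

variable {ι κ E L : Type*} [NormedAddCommGroup E] [InnerProductSpace ℂ E]
  [NormedAddCommGroup L] [InnerProductSpace ℂ L] [CompleteSpace L]

/-- Common form of both comparisons: σ and g come from one basis, τ and the functionals p from the
other. The finite section is spanned by the g of the lowest ranks. -/
theorem sum_posPart_matching_le {r : ι → ℕ} {r' : κ → ℕ} {π : ι ≃ κ} {σ : ι → ℝ} {τ : κ → ℝ}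
    (hl : IsLowerSet (Set.range r)) (hr : Function.Injective r) (hr' : Function.Injective r')
    (hπ : ∀ i, r' (π i) = r i) (hσ : ∀ i j, r i ≤ r j → σ j ≤ σ i)
    (hτ : ∀ i j, r' i ≤ r' j → τ j ≤ τ i) (hτ0 : ∀ k, 0 ≤ τ k) (G : E →L[ℂ] L) (g : ι → E)
    (p : κ → E →L[ℂ] ℂ) {c K D : ℝ} (hc : 0 ≤ c)
    (hG : ∀ (n : ℕ) (u : Fin n → ι), Function.Injective u →
      ∀ η : Fin n → EuclideanSpace ℂ (Fin n), ‖synth η‖ ≤ 1 →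
        ∑ a, ∑ j, σ (u j) * ‖η a j‖ ^ 2 ≤
          D + c * ∑ a, ‖G (synth (fun j => g (u j)) (η a))‖ ^ 2)
    (hp : ∀ (n : ℕ) (u : Fin n → ι), Function.Injective u →
      ∀ (x : EuclideanSpace ℂ (Fin n)) (t : ℝ),
      0 ≤ t → (∀ k, t < τ k → p k (synth (fun j => g (u j)) x) = 0) →
        ‖G (synth (fun j => g (u j)) x)‖ ^ 2 ≤ K * t * ‖x‖ ^ 2) (F : Finset ι) :
    ∑ i ∈ F, max 0 (σ i - c * (K * τ (π i))) ≤ D := by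
  classical
  by_cases hF : F = ∅
  · have := hG 0 Fin.elim0 (fun i => i.elim0) Fin.elim0 (by
      rw [norm_synth_le_iff zero_le_one]; simp)
    subst hF
    simpa using this
  obtain ⟨i₀, hi₀, hmax⟩ := F.exists_max_image r (Finset.nonempty_iff_ne_empty.2 hF)
  obtain ⟨u, hu⟩ : ∃ u : Fin (r i₀ + 1) → ι, ∀ j, r (u j) = j :=
    ⟨fun j => (hl (Nat.le_of_lt_succ j.2) ⟨i₀, rfl⟩).choose,
      fun j => (hl (Nat.le_of_lt_succ j.2) ⟨i₀, rfl⟩).choose_spec⟩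
  have hinj : Function.Injective u := fun j l h => Fin.ext (by rw [← hu, ← hu, h])
  have hsub : F ⊆ Finset.univ.image u := fun i hi => Finset.mem_image.2
    ⟨⟨r i, Nat.lt_succ_of_le (hmax i hi)⟩, Finset.mem_univ _, hr (hu _)⟩
  calc ∑ i ∈ F, max 0 (σ i - c * (K * τ (π i)))
      ≤ ∑ i ∈ Finset.univ.image u, max 0 (σ i - c * (K * τ (π i))) :=
        Finset.sum_le_sum_of_subset_of_nonneg hsub fun _ _ _ => le_max_left _ _
    _ = ∑ j, max 0 (σ (u j) - c * (K * τ (π (u j)))) :=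
        Finset.sum_image fun _ _ _ _ h => hinj h
    _ ≤ D := by
        refine sum_posPart_sub_le (σ := fun j => σ (u j)) (τ := fun j => K * τ (π (u j)))
          (fun j l hjl => hσ _ _ (by rw [hu, hu]; exact hjl)) hc
          (G ∘L synth fun j => g (u j)) (hG _ u hinj) fun j => ?_
        refine ⟨LinearMap.pi fun l => (p (π (u (l.castLE j.2.le))) ∘L
          synth fun j => g (u j)).toLinearMap, fun x hx => ?_⟩
        refine hp _ u hinj x _ (hτ0 _) fun k hk => ?_
        -- Every k with τ k above the level of π(u j) has rank below j, so the j functionals already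
        -- chosen include p k.
        have hkj : r' k < j := by
          by_contra hkj
          refine hk.not_ge (hτ _ _ ?_)
          rw [hπ, hu]
          exact not_lt.1 hkj
        have hk' : k = π (u ((⟨r' k, hkj⟩ : Fin j).castLE j.2.le)) :=
          hr' (by rw [hπ, hu]; rfl)
        rw [hk']
        exact congrFun hx ⟨r' k, hkj⟩

/-- The weights p are uniformly at most q, so the perturbation ε and the excess of T over c(S + ε),
both summable, cost only a multiple of q. -/
theorem sum_mul_le_of_sum_posPart_le (F : Finset ι) {S T ε p : ι → ℝ} {c D q : ℝ} (hc : 0 ≤ c)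
    (hp : ∀ i, 0 ≤ p i) (hpq : ∀ i, p i ≤ q) (hε : ∀ i, 0 ≤ ε i) (hε1 : ∑ i ∈ F, ε i ≤ 1)
    (hD : ∑ i ∈ F, max 0 (T i - c * (S i + ε i)) ≤ D) (hq : 0 ≤ q) :
    ∑ i ∈ F, T i * p i ≤ c * ∑ i ∈ F, S i * p i + (c + D) * q := by
  calc ∑ i ∈ F, T i * p i
      ≤ ∑ i ∈ F, (c * (S i * p i) + c * q * ε i + q * max 0 (T i - c * (S i + ε i))) := by
        refine Finset.sum_le_sum fun i _ => ?_
        have h1 : T i ≤ c * (S i + ε i) + max 0 (T i - c * (S i + ε i)) := by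
          linarith [le_max_right 0 (T i - c * (S i + ε i))]
        have h2 := mul_le_mul_of_nonneg_right h1 (hp i)
        have h3 : c * ε i * p i ≤ c * ε i * q :=
          mul_le_mul_of_nonneg_left (hpq i) (mul_nonneg hc (hε i))
        have h4 : max 0 (T i - c * (S i + ε i)) * p i ≤ max 0 (T i - c * (S i + ε i)) * q :=
          mul_le_mul_of_nonneg_left (hpq i) (le_max_left _ _)
        linarith
    _ = c * ∑ i ∈ F, S i * p i + c * q * ∑ i ∈ F, ε i +
          q * ∑ i ∈ F, max 0 (T i - c * (S i + ε i)) := by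
        simp only [Finset.sum_add_distrib, Finset.mul_sum]
    _ ≤ c * ∑ i ∈ F, S i * p i + c * q * 1 + q * D := by gcongr
    _ = _ := by ring

end Matching

/-! ### Diagonal operators, eigenbases and perturbations. -/

section Diagonal

variable {ι κ E L : Type*} [NormedAddCommGroup E] [InnerProductSpace ℂ E] [CompleteSpace E]
  [NormedAddCommGroup L] [InnerProductSpace ℂ L] [CompleteSpace L] {n : ℕ}

theorem inner_map_map_of_eigen {B : E →L[ℂ] L} {x : E} {s : ℂ} (h : B.adjoint (B x) = s • x)
    (y : E) : ⟪B x, B y⟫_ℂ = (starRingEnd ℂ) s * ⟪x, y⟫_ℂ := by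
  rw [← ContinuousLinearMap.adjoint_inner_left, h, inner_smul_left]

/-- The images of distinct eigenvectors of B*B are orthogonal: this is Parseval for B. -/
theorem hasSum_norm_sq_map {B : E →L[ℂ] L} (b : HilbertBasis κ ℂ E)
    (hb : ∀ k, ∃ s : ℂ, B.adjoint (B (b k)) = s • b k) (y : E) :
    HasSum (fun k => ‖B (b k)‖ ^ 2 * ‖⟪b k, y⟫_ℂ‖ ^ 2) (‖B y‖ ^ 2) := by
  have h := b.hasSum_inner_mul_inner y (B.adjoint (B y))
  rw [ContinuousLinearMap.adjoint_inner_right] at h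
  have h' := Complex.hasSum_re h
  rw [← RCLike.re_eq_complex_re, ← norm_sq_eq_re_inner] at h'
  refine h'.congr_fun fun k => ?_
  obtain ⟨s, hs⟩ := hb k
  have h1 := inner_map_map_of_eigen hs y
  have h2 := inner_map_map_of_eigen hs (b k)
  rw [inner_self_eq_norm_sq_to_K, inner_self_eq_norm_sq_to_K, b.orthonormal.1] at h2
  have h3 : ((‖B (b k)‖ ^ 2 : ℝ) : ℂ) = (starRingEnd ℂ) s := by simpa using h2
  rw [ContinuousLinearMap.adjoint_inner_right, h1, ← h3, ← inner_conj_symm y, mul_left_comm,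
    RCLike.conj_mul]
  simp [← Complex.ofReal_pow]

theorem norm_sq_map_le_of_inner_eq_zero {B : E →L[ℂ] L} (b : HilbertBasis κ ℂ E)
    (hb : ∀ k, ∃ s : ℂ, B.adjoint (B (b k)) = s • b k) {t : ℝ} {y : E}
    (hy : ∀ k, t < ‖B (b k)‖ ^ 2 → ⟪b k, y⟫_ℂ = 0) : ‖B y‖ ^ 2 ≤ t * ‖y‖ ^ 2 := by
  have h2 : HasSum (fun k => ‖⟪b k, y⟫_ℂ‖ ^ 2) (‖y‖ ^ 2) := by
    have := hasSum_norm_sq_ell2 (b.repr y)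
    simpa [b.repr_apply_apply] using this
  refine hasSum_le (fun k => ?_) (hasSum_norm_sq_map b hb y) (h2.mul_left t)
  rcases le_or_gt (‖B (b k)‖ ^ 2) t with h | h
  · gcongr
  · simp [hy k h]

theorem norm_sq_diagOp_le {d : ι → ℂ} (hd : ∀ i, ‖d i‖ ≤ 1) {t : ℝ} {y : ℓ²(ι, ℂ)}
    (hy : ∀ i, t < ‖d i‖ ^ 2 → y i = 0) : ‖diagOp d hd y‖ ^ 2 ≤ t * ‖y‖ ^ 2 := by
  refine hasSum_le (fun i => ?_) (hasSum_norm_sq_ell2 _) ((hasSum_norm_sq_ell2 y).mul_left t)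
  rw [diagOp_apply, norm_mul, mul_pow]
  rcases le_or_gt (‖d i‖ ^ 2) t with h | h
  · gcongr
  · simp [hy i h]

/-- Kernel vectors would have infinitely many predecessors in a decreasing numbering. Adding a
summable positive family makes all values positive, while they still tend to 0. -/
theorem exists_pos_perturbation [Countable ι] {T : ι → ℝ}
    (hT : ∀ ε > 0, {i | ε ≤ T i}.Finite) :
    ∃ e : ι → ℝ, (∀ i, 0 < e i) ∧ (∀ F : Finset ι, ∑ i ∈ F, e i ≤ 1) ∧
      ∀ ε > 0, {i | ε ≤ T i + e i}.Finite := by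
  have := Encodable.ofCountable ι
  obtain ⟨e, he, c, hc, hc1⟩ := posSumOfEncodable one_pos ι
  refine ⟨e, he, fun F => (sum_le_hasSum F (fun i _ => (he i).le) hc).trans hc1,
    fun ε hε => ?_⟩
  have h1 : {i | ε / 2 ≤ e i}.Finite := by
    have := hc.summable.tendsto_cofinite_zero.eventually (gt_mem_nhds (half_pos hε))
    rw [Filter.eventually_cofinite] at this
    exact this.subset fun i hi => not_lt.2 hi
  refine ((hT _ (half_pos hε)).union h1).subset fun i hi => ?_
  by_contra hcon
  have hi' : ε ≤ T i + e i := hi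
  simp only [Set.mem_union, Set.mem_ofPred_eq, not_or, not_le] at hcon
  linarith [hcon.1, hcon.2]

end Diagonal

section Matching

variable {ι κ E L : Type*} [NormedAddCommGroup E] [InnerProductSpace ℂ E]
  [NormedAddCommGroup L] [InnerProductSpace ℂ L] {n : ℕ}

theorem synth_single_apply [DecidableEq ι] {u : Fin n → ι} (hu : Function.Injective u)
    (x : EuclideanSpace ℂ (Fin n)) (j : Fin n) :
    synth (fun l => (lp.single 2 (u l) 1 : ℓ²(ι, ℂ))) x (u j) = x j := by
  rw [synth_apply]
  simp only [lp.coeFn_sum, Finset.sum_apply, lp.coeFn_smul, Pi.smul_apply, lp.single_apply,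
    Pi.single_apply, hu.eq_iff]
  simp

theorem norm_synth_orthonormal_le {g : ι → E} (hg : Orthonormal ℂ g) {u : Fin n → ι}
    (hu : Function.Injective u) : ‖synth fun l => g (u l)‖ ≤ 1 :=
  norm_synth_le_one_of_orthogonal (fun _ => (hg.1 _).le) fun _ _ hab => hg.2 (hu.ne hab)

theorem inner_synth_orthonormal {g : ι → E} (hg : Orthonormal ℂ g) {u : Fin n → ι}
    (hu : Function.Injective u) (x : EuclideanSpace ℂ (Fin n)) (j : Fin n) :
    ⟪g (u j), synth (fun l => g (u l)) x⟫_ℂ = x j := by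
  rw [synth_apply]
  exact (hg.comp u hu).inner_right_fintype x j

theorem orthonormal_single [DecidableEq ι] :
    Orthonormal ℂ fun i => (lp.single 2 i 1 : ℓ²(ι, ℂ)) := by
  refine ⟨fun i => by simp [lp.norm_single], fun i j hij => ?_⟩
  change ⟪(lp.single 2 i 1 : ℓ²(ι, ℂ)), lp.single 2 j 1⟫_ℂ = 0
  rw [lp.inner_single_left, lp.single_apply, Pi.single_eq_of_ne hij, inner_zero_right]

theorem sum_eps_le {ε : ι → ℝ} (hε : ∀ i, 0 < ε i) (hε1 : ∀ F : Finset ι, ∑ i ∈ F, ε i ≤ 1)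
    {u : Fin n → ι} (hu : Function.Injective u) {q : Fin n → ℝ} (hq : ∀ j, q j ≤ 1) :
    ∑ j, ε (u j) * q j ≤ 1 := by
  classical
  refine le_trans (Finset.sum_le_sum fun j _ =>
    mul_le_of_le_one_right (hε (u j)).le (hq j)) ?_
  rw [← Finset.sum_image (f := ε) fun _ _ _ _ h => hu h]
  exact hε1 _

theorem sum_coordinate_sq_le_one {m : ℕ} {η : Fin n → EuclideanSpace ℂ (Fin m)}
    (hη : ‖synth η‖ ≤ 1) (j : Fin m) : ∑ a, ‖η a j‖ ^ 2 ≤ 1 := by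
  refine (sum_norm_sq_apply_le (EuclideanSpace.proj j) η).trans ?_
  refine pow_le_one₀ (by positivity) (mul_le_one₀ ?_ (norm_nonneg _) hη)
  exact ContinuousLinearMap.opNorm_le_bound _ zero_le_one fun x => by
    simpa using PiLp.norm_apply_le x j

theorem summable_inner_sq_hilbertBasis (b : HilbertBasis κ ℂ E) (x : E) :
    Summable fun k => ‖⟪x, b k⟫_ℂ‖ ^ 2 := by
  refine (hasSum_norm_sq_ell2 (b.repr x)).summable.congr fun k => ?_
  rw [b.repr_apply_apply, norm_inner_symm]

variable [CompleteSpace E] [CompleteSpace L] {C : ℝ} {B : E →L[ℂ] L} {f : ι → E}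
  {r : ι → ℕ} {r' : κ → ℕ} {π : ι ≃ κ} {ε : ι → ℝ} {ε' : κ → ℝ}

namespace IsColumnUnconditional

/-- Here G = B and g = f, and the column with entries Σ_j η_a(j) f_{u j} has S-coordinates η. In C⁴
+ 1, one C² comes from unconditionality, another from the norm of the synthesis of f, and 1 pays for
ε. -/
theorem sum_posPart_sub_le_of_basis [DecidableEq ι]
    (hf : IsColumnUnconditional C B f) {S : E ≃L[ℂ] ℓ²(ι, ℂ)}
    (hS : ∀ i, S (f i) = lp.single 2 i 1) (hS' : ∀ y, ‖S.symm y‖ ≤ C * ‖y‖)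
    (b : HilbertBasis κ ℂ E) (hb : ∀ k, ∃ s : ℂ, B.adjoint (B (b k)) = s • b k)
    (hl : IsLowerSet (Set.range r)) (hr : Function.Injective r) (hr' : Function.Injective r')
    (hπ : ∀ i, r' (π i) = r i)
    (hσ : ∀ i j, r i ≤ r j → ‖B (f j)‖ ^ 2 + ε j ≤ ‖B (f i)‖ ^ 2 + ε i)
    (hτ : ∀ i j, r' i ≤ r' j → ‖B (b j)‖ ^ 2 + ε' j ≤ ‖B (b i)‖ ^ 2 + ε' i)
    (hε : ∀ i, 0 < ε i) (hε1 : ∀ F : Finset ι, ∑ i ∈ F, ε i ≤ 1) (hε' : ∀ k, 0 < ε' k)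
    (F : Finset ι) :
    ∑ i ∈ F, max 0 (‖B (f i)‖ ^ 2 + ε i - C ^ 2 * (C ^ 2 * (‖B (b (π i))‖ ^ 2 + ε' (π i)))) ≤
      C ^ 4 + 1 := by
  have hC : 0 ≤ C := zero_le_one.trans hf.one_le
  have hSsynth : ∀ (n : ℕ) (u : Fin n → ι) (x : EuclideanSpace ℂ (Fin n)),
      synth (fun j => f (u j)) x = S.symm (synth (fun l => lp.single 2 (u l) 1) x) :=
    fun n u x => by
    simp [synth_apply, map_sum, ← hS]
  have hnorm : ∀ (n : ℕ) (u : Fin n → ι), Function.Injective u →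
      ‖synth fun j => f (u j)‖ ≤ C := fun n u hu => by
    refine ContinuousLinearMap.opNorm_le_bound _ hC fun x => ?_
    rw [hSsynth]
    refine (hS' _).trans ?_
    gcongr
    exact (synth fun l => (lp.single 2 (u l) 1 : ℓ²(ι, ℂ))).le_of_opNorm_le
      (norm_synth_orthonormal_le orthonormal_single hu) x |>.trans (by simp)
  refine sum_posPart_matching_le (τ := fun k => ‖B (b k)‖ ^ 2 + ε' k) hl hr hr' hπ hσ hτ
    (fun k => add_nonneg (by positivity) (hε' k).le) B f (fun k => innerSL ℂ (b k))
    (by positivity) (fun n u hu η hη => ?_) (fun n u hu x t ht hx => ?_) F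
  · have h1 := hf.sum_coordinates_le_mass hS (Finset.univ.image u)
      fun a => synth (fun j => f (u j)) (η a)
    rw [Finset.sum_image fun _ _ _ _ h => hu h] at h1
    simp only [hSsynth _ u, ContinuousLinearEquiv.apply_symm_apply, synth_single_apply hu] at h1
    simp only [← hSsynth _ u] at h1
    have h2 : mass B (fun a => synth (fun j => f (u j)) (η a)) ≤
        C ^ 2 + ∑ a, ‖B (synth (fun j => f (u j)) (η a))‖ ^ 2 := by
      refine max_le ?_ (le_add_of_nonneg_left (by positivity))
      refine le_add_of_le_of_nonneg ?_ (by positivity)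
      gcongr
      refine (norm_synth_comp_le _ _).trans ?_
      exact (mul_le_mul (hnorm n u hu) hη (norm_nonneg _) hC).trans_eq (mul_one _)
    have h3 := sum_eps_le hε hε1 hu fun j => sum_coordinate_sq_le_one hη j
    have h4 : ∑ a, ∑ j, (‖B (f (u j))‖ ^ 2 + ε (u j)) * ‖η a j‖ ^ 2 =
        ∑ j, ‖B (f (u j))‖ ^ 2 * ∑ a, ‖η a j‖ ^ 2 + ∑ j, ε (u j) * ∑ a, ‖η a j‖ ^ 2 := by
      rw [Finset.sum_comm]
      simp only [Finset.mul_sum, add_mul, Finset.sum_add_distrib]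
    rw [h4]
    have h5 := mul_le_mul_of_nonneg_left h2 (sq_nonneg C)
    nlinarith
  · refine (norm_sq_map_le_of_inner_eq_zero b hb (t := t) fun k hk => ?_).trans ?_
    · exact hx k (hk.trans_le (le_add_of_nonneg_right (hε' k).le))
    · have h1 : ‖synth (fun j => f (u j)) x‖ ^ 2 ≤ (C * ‖x‖) ^ 2 := by
        gcongr
        exact (synth fun j => f (u j)).le_of_opNorm_le (hnorm n u hu) x
      calc t * ‖synth (fun j => f (u j)) x‖ ^ 2 ≤ t * (C * ‖x‖) ^ 2 := by gcongr
        _ = _ := by ring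

/-- The roles are exchanged: G = DS, g = b, and the functionals are the S-coordinates. The constant
C⁶ is C² times the square of C·‖S‖ ≤ C², and 1 pays for ε'. -/
theorem sum_posPart_basis_sub_le [DecidableEq ι]
    (hf : IsColumnUnconditional C B f) {S : E ≃L[ℂ] ℓ²(ι, ℂ)}
    (hS : ∀ i, S (f i) = lp.single 2 i 1) (hSn : ∀ x, ‖S x‖ ≤ C * ‖x‖)
    (hS' : ∀ y, ‖S.symm y‖ ≤ C * ‖y‖) {d : ι → ℂ} (hd : ∀ i, ‖d i‖ ≤ 1)
    (hdB : ∀ i, ‖d i‖ = ‖B (f i)‖)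
    (b : HilbertBasis κ ℂ E) (hb : ∀ k, ∃ s : ℂ, B.adjoint (B (b k)) = s • b k)
    (hl : IsLowerSet (Set.range r')) (hr : Function.Injective r) (hr' : Function.Injective r')
    (hπ : ∀ i, r' (π i) = r i)
    (hσ : ∀ i j, r i ≤ r j → ‖B (f j)‖ ^ 2 + ε j ≤ ‖B (f i)‖ ^ 2 + ε i)
    (hτ : ∀ i j, r' i ≤ r' j → ‖B (b j)‖ ^ 2 + ε' j ≤ ‖B (b i)‖ ^ 2 + ε' i)
    (hε : ∀ i, 0 < ε i) (hε' : ∀ k, 0 < ε' k) (hε1' : ∀ F : Finset κ, ∑ k ∈ F, ε' k ≤ 1)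
    (F : Finset κ) :
    ∑ k ∈ F, max 0 (‖B (b k)‖ ^ 2 + ε' k -
      C ^ 2 * (C ^ 2 * (‖B (f (π.symm k))‖ ^ 2 + ε (π.symm k)))) ≤ C ^ 6 + 1 := by
  classical
  have hC : 0 ≤ C := zero_le_one.trans hf.one_le
  have hSC : ‖(S : E →L[ℂ] ℓ²(ι, ℂ))‖ ≤ C := ContinuousLinearMap.opNorm_le_bound _ hC hSn
  refine sum_posPart_matching_le (τ := fun i => ‖B (f i)‖ ^ 2 + ε i) hl hr' hr
    (fun k => by rw [← hπ, Equiv.apply_symm_apply]) hτ hσ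
    (fun k => add_nonneg (by positivity) (hε k).le)
    (diagOp d hd ∘L (S : E →L[ℂ] ℓ²(ι, ℂ))) b (fun i => coord i ∘L (S : E →L[ℂ] ℓ²(ι, ℂ)))
    (by positivity) (fun n u hu η hη => ?_) (fun n u hu x t ht hx => ?_) F
  · have hn1 : ‖synth fun a => synth (fun j => b (u j)) (η a)‖ ≤ 1 := by
      refine (norm_synth_comp_le _ _).trans ?_
      exact mul_le_one₀ (norm_synth_orthonormal_le b.orthonormal hu) (norm_nonneg _) hη
    have h1 := hf.sum_norm_sq_le_coordinates hS hS' hd hdB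
      fun a => synth (fun j => b (u j)) (η a)
    have h2 : max ((C * ‖synth fun a => S (synth (fun j => b (u j)) (η a))‖) ^ 2)
        (∑ a, ‖diagOp d hd (S (synth (fun j => b (u j)) (η a)))‖ ^ 2) ≤
        C ^ 4 + ∑ a, ‖diagOp d hd (S (synth (fun j => b (u j)) (η a)))‖ ^ 2 := by
      refine max_le ?_ (le_add_of_nonneg_left (by positivity))
      refine le_add_of_le_of_nonneg ?_ (by positivity)
      have : ‖synth fun a => S (synth (fun j => b (u j)) (η a))‖ ≤ C * 1 :=
        (norm_synth_comp_le (S : E →L[ℂ] ℓ²(ι, ℂ)) _).trans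
          (mul_le_mul hSC hn1 (norm_nonneg _) hC)
      calc (C * ‖synth fun a => S (synth (fun j => b (u j)) (η a))‖) ^ 2
          ≤ (C * (C * 1)) ^ 2 := by gcongr
        _ = C ^ 4 := by ring
    have h3 := sum_eps_le hε' hε1' hu fun j => sum_coordinate_sq_le_one hη j
    have h4 : ∑ a, ∑ j, (‖B (b (u j))‖ ^ 2 + ε' (u j)) * ‖η a j‖ ^ 2 =
        ∑ a, ∑ j, ‖B (b (u j))‖ ^ 2 * ‖η a j‖ ^ 2 + ∑ j, ε' (u j) * ∑ a, ‖η a j‖ ^ 2 := by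
      simp only [add_mul, Finset.sum_add_distrib, Finset.mul_sum]
      rw [Finset.sum_comm (f := fun j a => ε' (u j) * ‖η a j‖ ^ 2)]
    have h5 : ∑ a, ∑ j, ‖B (b (u j))‖ ^ 2 * ‖η a j‖ ^ 2 ≤
        ∑ a, ‖B (synth (fun j => b (u j)) (η a))‖ ^ 2 := by
      refine Finset.sum_le_sum fun a _ => ?_
      have h := sum_le_hasSum (Finset.univ.image u) (fun _ _ => by positivity)
        (hasSum_norm_sq_map b hb (synth (fun j => b (u j)) (η a)))
      rw [Finset.sum_image fun _ _ _ _ h => hu h] at h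
      simpa only [inner_synth_orthonormal b.orthonormal hu] using h
    have h6 := mul_le_mul_of_nonneg_left h2 (sq_nonneg C)
    rw [h4]
    simp only [ContinuousLinearMap.comp_apply, ContinuousLinearEquiv.coe_coe]
    nlinarith
  · refine (norm_sq_diagOp_le hd (t := t) fun i hi => ?_).trans ?_
    · rw [hdB] at hi
      exact hx i (hi.trans_le (le_add_of_nonneg_right (hε i).le))
    · have h1 : ‖S (synth (fun j => b (u j)) x)‖ ≤ C * ‖x‖ := by
        refine (hSn _).trans ?_
        gcongr
        exact (synth fun j => b (u j)).le_of_opNorm_le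
          (norm_synth_orthonormal_le b.orthonormal hu) x |>.trans (by simp)
      calc t * ‖(S : E →L[ℂ] ℓ²(ι, ℂ)) (synth (fun j => b (u j)) x)‖ ^ 2
          ≤ t * (C * ‖x‖) ^ 2 := by gcongr; exact h1
        _ = _ := by ring

end IsColumnUnconditional

end Matching

/-! ### The equivalence with an eigenbasis at the level of columns. -/

section Comparison

variable {ι κ E L : Type*} [NormedAddCommGroup E] [InnerProductSpace ℂ E] [CompleteSpace E]
  [NormedAddCommGroup L] [InnerProductSpace ℂ L] [CompleteSpace L] {n : ℕ}

theorem finite_le_norm_sq_of_isCompactOperator {B : E →L[ℂ] L} (hB : IsCompactOperator B)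
    {f : ι → E} (hf : ∀ i, ‖f i‖ = 1) (hs : ∀ x, Summable fun i => ‖⟪x, f i⟫_ℂ‖ ^ 2) (ε : ℝ)
    (hε : 0 < ε) : {i | ε ≤ ‖B (f i)‖ ^ 2}.Finite :=
  (finite_le_norm_of_isCompactOperator hB hf hs (Real.sqrt_pos.2 hε)).subset fun _ hi =>
    Real.sqrt_le_iff.2 ⟨norm_nonneg _, hi⟩

theorem exists_hilbertBasis_reindex (b : HilbertBasis κ ℂ E) (π : ι ≃ κ) :
    ∃ b' : HilbertBasis ι ℂ E, ∀ i, b' i = b (π i) := by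
  have hr : Set.range (fun i => b (π i)) = Set.range b := π.surjective.range_comp b
  refine ⟨HilbertBasis.mk (b.orthonormal.comp π π.injective) ?_, fun i => ?_⟩
  · exact (congrArg _ (congrArg _ hr)).trans b.dense_span |>.ge
  · rw [HilbertBasis.coe_mk]
    rfl

variable {C : ℝ} {B : E →L[ℂ] L} {f : ι → E}

/-- A column-unconditional sequence can be matched with an eigenbasis of `B† B` so that the sums of
the positive parts of the differences of the squared norms stay bounded. -/
theorem IsColumnUnconditional.exists_equiv_sum_posPart_le [DecidableEq ι] (hB : ‖B‖ ≤ 1)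
    (hBc : IsCompactOperator B) {δ : ℕ → E} (hδ : ∀ x, (∀ m, ⟪δ m, x⟫_ℂ = 0) → x = 0)
    (hf : IsColumnUnconditional C B f) {S : E ≃L[ℂ] ℓ²(ι, ℂ)}
    (hS : ∀ i, S (f i) = lp.single 2 i 1) (hSn : ∀ x, ‖S x‖ ≤ C * ‖x‖)
    (hS' : ∀ y, ‖S.symm y‖ ≤ C * ‖y‖) {d : ι → ℂ} (hd : ∀ i, ‖d i‖ ≤ 1)
    (hdB : ∀ i, ‖d i‖ = ‖B (f i)‖) (b : HilbertBasis κ ℂ E)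
    (hb : ∀ k, ∃ s : ℂ, B.adjoint (B (b k)) = s • b k) :
    ∃ (π : ι ≃ κ) (ε ε' : ι → ℝ), (∀ i, 0 ≤ ε i) ∧ (∀ i, 0 ≤ ε' i) ∧
      (∀ F : Finset ι, ∑ i ∈ F, ε i ≤ 1) ∧ (∀ F : Finset ι, ∑ i ∈ F, ε' i ≤ 1) ∧
      (∀ F : Finset ι, ∑ i ∈ F, max 0 (‖B (f i)‖ ^ 2 - C ^ 4 * (‖B (b (π i))‖ ^ 2 + ε' i)) ≤
        C ^ 4 + 1) ∧
      ∀ F : Finset ι, ∑ i ∈ F, max 0 (‖B (b (π i))‖ ^ 2 - C ^ 4 * (‖B (f i)‖ ^ 2 + ε i)) ≤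
        C ^ 6 + 1 := by
  have hsf := hf.summable_inner_sq hB
  have hsb := summable_inner_sq_hilbertBasis b
  have : Countable ι := countable_of_summable
    (fun i h => by simpa [h] using hf.norm_eq i) hsf hδ
  have : Countable κ := countable_of_summable (fun k => b.orthonormal.ne_zero k) hsb hδ
  obtain ⟨ε, hε, hε1, hεf⟩ := exists_pos_perturbation
    (finite_le_norm_sq_of_isCompactOperator hBc hf.norm_eq hsf)
  obtain ⟨ε', hε', hε1', hεb⟩ := exists_pos_perturbation
    (finite_le_norm_sq_of_isCompactOperator hBc b.orthonormal.1 hsb)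
  obtain ⟨r, hr, hl, hσ⟩ := exists_rank
    (fun i => add_pos_of_nonneg_of_pos (sq_nonneg ‖B (f i)‖) (hε i)) hεf
  obtain ⟨r', hr', hl', hτ⟩ := exists_rank
    (fun k => add_pos_of_nonneg_of_pos (sq_nonneg ‖B (b k)‖) (hε' k)) hεb
  -- Only the equality of cardinalities is used; the matching itself is by rank.
  obtain ⟨e⟩ := nonempty_equiv_of_hilbertBasis
    (HilbertBasis.ofRepr (LinearIsometryEquiv.refl ℂ ℓ²(ι, ℂ))) b S.symm
  obtain ⟨π, hπ⟩ := exists_equiv_rank_eq e hr hr' hl hl'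
  refine ⟨π, ε, fun i => ε' (π i), fun i => (hε i).le, fun i => (hε' _).le, hε1, fun F => ?_,
    fun F => ?_, fun F => ?_⟩
  · simpa using hε1' (F.map π.toEmbedding)
  · refine le_trans (Finset.sum_le_sum fun i _ => max_le_max le_rfl ?_)
      (hf.sum_posPart_sub_le_of_basis hS hS' b hb hl hr hr' hπ hσ hτ hε hε1 hε' F)
    nlinarith [hε i]
  · have h := hf.sum_posPart_basis_sub_le hS hSn hS' hd hdB b hb hl' hr hr' hπ hσ hτ hε hε' hε1'
      (F.map π.toEmbedding)
    rw [Finset.sum_map] at h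
    refine le_trans (Finset.sum_le_sum fun i _ => max_le_max le_rfl ?_) h
    simp only [Equiv.coe_toEmbedding, Equiv.symm_apply_apply]
    nlinarith [hε' (π i)]

/-- A column-unconditional sequence is equivalent, up to a permutation, to any orthonormal
eigenbasis of `B† B`. -/
theorem IsColumnUnconditional.exists_equiv_mass_le (hB : ‖B‖ ≤ 1)
    (hBc : IsCompactOperator B) {δ : ℕ → E} (hδ : ∀ x, (∀ m, ⟪δ m, x⟫_ℂ = 0) → x = 0)
    (hf : IsColumnUnconditional C B f) (b : HilbertBasis κ ℂ E)
    (hb : ∀ k, ∃ s : ℂ, B.adjoint (B (b k)) = s • b k) :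
    ∃ (π : ι ≃ κ) (U : E ≃L[ℂ] E), (∀ i, U (f i) = b (π i)) ∧
      (∀ (n : ℕ) (η : Fin n → E), mass B (fun a => U (η a)) ≤ (2 * C ^ 4) ^ 2 * mass B η) ∧
      ∀ (n : ℕ) (η : Fin n → E), mass B (fun a => U.symm (η a)) ≤ (2 * C ^ 3) ^ 2 * mass B η := by
  classical
  have hC1 := hf.one_le
  have hC : 0 ≤ C := zero_le_one.trans hf.one_le
  obtain ⟨S, hS, hSn, hS'⟩ := hf.exists_coordinates hB
  let d : ι → ℂ := fun i => (‖B (f i)‖ : ℂ)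
  have hdB : ∀ i, ‖d i‖ = ‖B (f i)‖ := fun i => by simp [d]
  have hd : ∀ i, ‖d i‖ ≤ 1 := fun i => (hdB i).trans_le (hf.norm_map_le_one hB i)
  obtain ⟨π, ε, ε', hε, hε', hε1, hε1', h1, h2⟩ :=
    hf.exists_equiv_sum_posPart_le hB hBc hδ hS hSn hS' hd hdB b hb
  obtain ⟨b', hb'⟩ := exists_hilbertBasis_reindex b π
  simp only [← hb'] at h1 h2
  have hbE : ∀ i, ∃ s : ℂ, B.adjoint (B (b' i)) = s • b' i := fun i => hb' i ▸ hb (π i)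
  let U : E ≃L[ℂ] E := S.trans b'.repr.symm.toContinuousLinearEquiv
  have hUS : ∀ x, b'.repr (U x) = S x := fun x => by simp [U]
  have hUS' : ∀ x, S (U.symm x) = b'.repr x := fun x => by simp [U]
  have hin : ∀ x i, ⟪b' i, U x⟫_ℂ = S x i := fun x i => by
    rw [← b'.repr_apply_apply, hUS]
  have hin' : ∀ x i, S (U.symm x) i = ⟪b' i, x⟫_ℂ := fun x i => by
    rw [hUS', b'.repr_apply_apply]
  have hSC : ‖(S : E →L[ℂ] ℓ²(ι, ℂ))‖ ≤ C := ContinuousLinearMap.opNorm_le_bound _ hC hSn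
  have hC2 : C ^ 2 ≤ C ^ 8 := pow_le_pow_right₀ hC1 (by norm_num)
  have hC6 : C ^ 6 ≤ C ^ 8 := pow_le_pow_right₀ hC1 (by norm_num)
  have hC26 : C ^ 2 ≤ C ^ 6 := pow_le_pow_right₀ hC1 (by norm_num)
  have hC24 : C ^ 2 ≤ C ^ 4 := pow_le_pow_right₀ hC1 (by norm_num)
  have hC4 : 1 ≤ C ^ 4 := one_le_pow₀ hC1
  have hUn : ‖(U : E →L[ℂ] E)‖ ≤ C := ContinuousLinearMap.opNorm_le_bound _ hC fun x => by
    simpa [U] using hSn x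
  have hUn' : ‖(U.symm : E →L[ℂ] E)‖ ≤ C := ContinuousLinearMap.opNorm_le_bound _ hC fun x => by
    simpa [U] using hS' (b'.repr x)
  refine ⟨π, U, fun i => ?_, fun n η => max_le ?_ ?_, fun n η => max_le ?_ ?_⟩
  · rw [← hb', ← b'.repr_symm_single, ← hS]
    rfl
  · have hM : ‖synth η‖ ^ 2 ≤ mass B η := le_max_left _ _
    calc ‖synth fun a => U (η a)‖ ^ 2 ≤ (C * ‖synth η‖) ^ 2 := by
          gcongr
          exact (norm_synth_comp_le (U : E →L[ℂ] E) η).trans (by gcongr)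
      _ = C ^ 2 * ‖synth η‖ ^ 2 := by ring
      _ ≤ (2 * C ^ 4) ^ 2 * mass B η := by
          gcongr
          nlinarith
  · have hM : ‖synth η‖ ^ 2 ≤ mass B η := le_max_left _ _
    have hM0 := mass_nonneg B η
    have hsum : HasSum (fun i => ‖B (b' i)‖ ^ 2 * ∑ a, ‖S (η a) i‖ ^ 2)
        (∑ a, ‖B (U (η a))‖ ^ 2) := by
      have := hasSum_sum (s := Finset.univ) fun a _ => hasSum_norm_sq_map b' hbE (U (η a))
      simpa only [hin, ← Finset.mul_sum] using this
    refine hasSum_le_of_sum_le hsum fun F => ?_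
    -- The weight at one coordinate is controlled by the operator-norm half alone; this is what
    -- absorbs the summable excess.
    have hp : ∀ i, ∑ a, ‖S (η a) i‖ ^ 2 ≤ C ^ 2 * mass B η := fun i => by
      refine (sum_norm_sq_apply_le (coord i ∘L (S : E →L[ℂ] ℓ²(ι, ℂ))) η).trans ?_
      have : ‖coord i ∘L (S : E →L[ℂ] ℓ²(ι, ℂ))‖ ≤ 1 * C :=
        (ContinuousLinearMap.opNorm_comp_le _ _).trans
          (mul_le_mul (norm_coord_le i) hSC (norm_nonneg _) zero_le_one)
      calc _ ≤ (1 * C * ‖synth η‖) ^ 2 := by gcongr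
        _ = C ^ 2 * ‖synth η‖ ^ 2 := by ring
        _ ≤ _ := by gcongr
    have key := sum_mul_le_of_sum_posPart_le F (by positivity : 0 ≤ C ^ 4)
      (fun i => by positivity) hp hε (hε1 F) (h2 F) (by positivity)
    have hP := hf.sum_coordinates_le_mass hS F η
    -- The first term is the C⁴-multiple of ‖DSV‖²_HS; the second carries c + D = C⁴ + (C⁶ + 1) and
    -- the weight bound C² times the mass.
    calc _ ≤ C ^ 4 * (C ^ 2 * mass B η) + (C ^ 4 + (C ^ 6 + 1)) * (C ^ 2 * mass B η) :=
          key.trans (by gcongr)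
      _ = (2 * C ^ 6 + C ^ 8 + C ^ 2) * mass B η := by ring
      _ ≤ (4 * C ^ 8) * mass B η := by gcongr; linarith
      _ = _ := by ring
  · have hM : ‖synth η‖ ^ 2 ≤ mass B η := le_max_left _ _
    calc ‖synth fun a => U.symm (η a)‖ ^ 2 ≤ (C * ‖synth η‖) ^ 2 := by
          gcongr
          exact (norm_synth_comp_le (U.symm : E →L[ℂ] E) η).trans (by gcongr)
      _ = C ^ 2 * ‖synth η‖ ^ 2 := by ring
      _ ≤ (2 * C ^ 3) ^ 2 * mass B η := by
          gcongr
          nlinarith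
  · have hM : ‖synth η‖ ^ 2 ≤ mass B η := le_max_left _ _
    have hM' : ∑ a, ‖B (η a)‖ ^ 2 ≤ mass B η := le_max_right _ _
    have hM0 := mass_nonneg B η
    have hD : ∑ a, ‖diagOp d hd (S (U.symm (η a)))‖ ^ 2 ≤ 4 * C ^ 4 * mass B η := by
      have hsum : HasSum (fun i => ‖B (f i)‖ ^ 2 * ∑ a, ‖⟪b' i, η a⟫_ℂ‖ ^ 2)
          (∑ a, ‖diagOp d hd (S (U.symm (η a)))‖ ^ 2) := by
        have := hasSum_sum (s := Finset.univ) fun a _ =>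
          hasSum_norm_sq_ell2 (diagOp d hd (S (U.symm (η a))))
        simpa only [diagOp_apply, norm_mul, mul_pow, hdB, hin', ← Finset.mul_sum] using this
      refine hasSum_le_of_sum_le hsum fun F => ?_
      have hp : ∀ i, ∑ a, ‖⟪b' i, η a⟫_ℂ‖ ^ 2 ≤ mass B η := fun i => by
        refine (sum_norm_sq_apply_le (innerSL ℂ (b' i)) η).trans ?_
        rw [innerSL_apply_norm, b'.orthonormal.1, one_mul]
        exact hM
      have key := sum_mul_le_of_sum_posPart_le F (by positivity : 0 ≤ C ^ 4)
        (fun i => by positivity) hp hε' (hε1' F) (h1 F) hM0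
      have hP : ∑ i ∈ F, ‖B (b' i)‖ ^ 2 * ∑ a, ‖⟪b' i, η a⟫_ℂ‖ ^ 2 ≤ ∑ a, ‖B (η a)‖ ^ 2 := by
        have := hasSum_sum (s := Finset.univ) fun a _ => hasSum_norm_sq_map b' hbE (η a)
        simp only [← Finset.mul_sum] at this
        exact sum_le_hasSum F (fun _ _ => by positivity) this
      calc _ ≤ C ^ 4 * mass B η + (C ^ 4 + (C ^ 4 + 1)) * mass B η :=
            key.trans (by gcongr; exact hP.trans hM')
        _ = (3 * C ^ 4 + 1) * mass B η := by ring
        _ ≤ _ := by gcongr; linarith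
    refine (hf.sum_norm_sq_le_coordinates hS hS' hd hdB _).trans ?_
    -- S ∘ U⁻¹ is the isometry onto the coordinates of the reindexed eigenbasis, so no factor C is
    -- lost here.
    have hsy : ‖synth fun a => S (U.symm (η a))‖ ≤ ‖synth η‖ := by
      simp only [hUS']
      refine (norm_synth_comp_le (b'.repr.toContinuousLinearEquiv : E →L[ℂ] ℓ²(ι, ℂ)) η).trans ?_
      refine mul_le_of_le_one_left (norm_nonneg _) ?_
      exact ContinuousLinearMap.opNorm_le_bound _ zero_le_one fun x => by simp
    calc _ ≤ C ^ 2 * (4 * C ^ 4 * mass B η) := by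
          gcongr
          refine max_le ?_ hD
          calc (C * ‖synth fun a => S (U.symm (η a))‖) ^ 2 ≤ (C * ‖synth η‖) ^ 2 := by gcongr
            _ = C ^ 2 * ‖synth η‖ ^ 2 := by ring
            _ ≤ (4 * C ^ 4) * mass B η := by
              gcongr
              linarith
      _ = _ := by ring

end Comparison

/-! ### Matrix norms in X(A). -/

section Operators

variable {n : ℕ}

theorem amplify_apply {H : Type*} [NormedAddCommGroup H] [InnerProductSpace ℂ H]
    (v : Matrix (Fin n) (Fin n) (H →L[ℂ] H)) (x : PiLp 2 fun _ : Fin n => H) (a : Fin n) :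
    amplify v x a = ∑ b, v a b (x b) := by
  simp [amplify]

theorem graphEmb_apply_fst (A : ell2 →L[ℂ] ell2) (ξ : ell2) (z : ell2Sum) :
    (graphEmb A ξ z).fst = ⟪star ξ, z.fst⟫_ℂ • delta 0 := rfl

theorem graphEmb_apply_snd (A : ell2 →L[ℂ] ell2) (ξ : ell2) (z : ell2Sum) :
    (graphEmb A ξ z).snd = ⟪delta 0, z.snd⟫_ℂ • A ξ := rfl

theorem norm_delta (i : ℕ) : ‖delta i‖ = 1 := by
  simp [delta, lp.norm_single]

theorem inner_delta (i : ℕ) (x : ell2) : ⟪delta i, x⟫_ℂ = x i := by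
  simp [delta, lp.inner_single_left]

theorem inner_star_star (x y : ell2) : ⟪star x, star y⟫_ℂ = ⟪y, x⟫_ℂ := by
  rw [lp.inner_eq_tsum, lp.inner_eq_tsum]
  refine tsum_congr fun i => ?_
  simp [mul_comm]

theorem norm_sq_amplify_graphEmb (A : ell2 →L[ℂ] ell2) (v : Matrix (Fin n) (Fin n) ell2)
    (x : PiLp 2 fun _ : Fin n => ell2Sum) :
    ‖amplify (v.map (graphEmb A)) x‖ ^ 2 = ∑ a, ‖∑ b, ⟪star (v a b), (x b).fst⟫_ℂ‖ ^ 2 +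
      ∑ a, ‖A (∑ b, ⟪delta 0, (x b).snd⟫_ℂ • v a b)‖ ^ 2 := by
  rw [PiLp.norm_sq_eq_of_L2, ← Finset.sum_add_distrib]
  refine Finset.sum_congr rfl fun a _ => ?_
  rw [WithLp.prod_norm_sq_eq_of_L2, amplify_apply]
  congr 2
  · rw [show (∑ b, (v.map (graphEmb A)) a b (x b)).fst =
        ∑ b, ((v.map (graphEmb A)) a b (x b)).fst from map_sum (WithLp.fstL 2 ℂ ell2 ell2) _ _]
    simp only [Matrix.map_apply, graphEmb_apply_fst, ← Finset.sum_smul]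
    rw [norm_smul, norm_delta, mul_one]
  · rw [show (∑ b, (v.map (graphEmb A)) a b (x b)).snd =
        ∑ b, ((v.map (graphEmb A)) a b (x b)).snd from map_sum (WithLp.sndL 2 ℂ ell2 ell2) _ _]
    simp only [Matrix.map_apply, graphEmb_apply_snd, map_sum, map_smul]

theorem norm_sum_mul_sq_le (x y : Fin n → ℂ) :
    ‖∑ a, x a * y a‖ ^ 2 ≤ (∑ a, ‖x a‖ ^ 2) * ∑ a, ‖y a‖ ^ 2 := by
  refine le_trans ?_ (Finset.sum_mul_sq_le_sq_mul_sq _ _ _)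
  gcongr
  exact (norm_sum_le _ _).trans_eq (by simp)

/-- The amplified operator splits into a row block and a column block acting on orthogonal summands.
The column block gives the second condition directly; the first is the bound for the adjoint of the
row block. -/
theorem matNorm_graphEmb_le_iff (A : ell2 →L[ℂ] ell2) (v : Matrix (Fin n) (Fin n) ell2) {K : ℝ}
    (hK : 0 ≤ K) : matNorm (v.map (graphEmb A)) ≤ K ↔
      (∀ β : Fin n → ℂ, ∑ b, ‖∑ a, β a • v a b‖ ^ 2 ≤ K ^ 2 * ∑ a, ‖β a‖ ^ 2) ∧
      ∀ h : Fin n → ℂ, ∑ a, ‖A (∑ b, h b • v a b)‖ ^ 2 ≤ K ^ 2 * ∑ b, ‖h b‖ ^ 2 := by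
  have hswap : ∀ (β : Fin n → ℂ) (x : Fin n → ell2),
      ∑ a, β a * ∑ b, ⟪star (v a b), x b⟫_ℂ = ∑ b, ⟪star (∑ a, β a • v a b), x b⟫_ℂ :=
    fun β x => by
      simp only [star_sum, star_smul, sum_inner, inner_smul_left, Finset.mul_sum]
      rw [Finset.sum_comm]
      simp
  have hiff : matNorm (v.map (graphEmb A)) ≤ K ↔ ∀ x : PiLp 2 fun _ : Fin n => ell2Sum,
      ∑ a, ‖∑ b, ⟪star (v a b), (x b).fst⟫_ℂ‖ ^ 2 +
        ∑ a, ‖A (∑ b, ⟪delta 0, (x b).snd⟫_ℂ • v a b)‖ ^ 2 ≤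
        K ^ 2 * ∑ b, (‖(x b).fst‖ ^ 2 + ‖(x b).snd‖ ^ 2) := by
    rw [matNorm, ContinuousLinearMap.opNorm_le_iff hK]
    refine forall_congr' fun x => ?_
    rw [← norm_sq_amplify_graphEmb, ← pow_le_pow_iff_left₀ (norm_nonneg _) (by positivity)
      two_ne_zero, mul_pow, PiLp.norm_sq_eq_of_L2 _ x]
    simp only [WithLp.prod_norm_sq_eq_of_L2]
  rw [hiff]
  constructor
  · refine fun H => ⟨fun β => ?_, fun h => ?_⟩
    · let y : Fin n → ell2 := fun b => ∑ a, β a • v a b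
      have h1 : ∑ a, ‖∑ b, ⟪star (v a b), star (y b)⟫_ℂ‖ ^ 2 +
          ∑ a, ‖A (∑ b, ⟪delta 0, (0 : ell2)⟫_ℂ • v a b)‖ ^ 2 ≤
          K ^ 2 * ∑ b, (‖star (y b)‖ ^ 2 + ‖(0 : ell2)‖ ^ 2) :=
        H (WithLp.toLp 2 fun b => WithLp.toLp 2 (star (y b), 0))
      have h2 : ‖∑ b, ⟪star (∑ a, β a • v a b), star (y b)⟫_ℂ‖ ^ 2 ≤ (∑ a, ‖β a‖ ^ 2) *
          ∑ a, ‖∑ b, ⟪star (v a b), star (y b)⟫_ℂ‖ ^ 2 := by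
        rw [← hswap]
        exact norm_sum_mul_sq_le β _
      simp only [inner_star_star] at h2
      simp only [inner_star_star, inner_zero_right, zero_smul, Finset.sum_const_zero, map_zero,
        norm_zero, ne_eq, OfNat.ofNat_ne_zero, not_false_eq_true, zero_pow, add_zero,
        norm_star] at h1
      have h3 : ∑ b, ⟪y b, ∑ a, β a • v a b⟫_ℂ = ((∑ b, ‖y b‖ ^ 2 : ℝ) : ℂ) := by
        push_cast
        exact Finset.sum_congr rfl fun b _ => inner_self_eq_norm_sq_to_K _
      rw [h3, Complex.norm_real, Real.norm_of_nonneg (by positivity)] at h2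
      have h4 : 0 ≤ ∑ b, ‖y b‖ ^ 2 := by positivity
      have h5 : 0 ≤ ∑ a, ‖β a‖ ^ 2 := by positivity
      change ∑ b, ‖y b‖ ^ 2 ≤ _
      rcases h4.eq_or_lt with h0 | h0
      · rw [← h0]; positivity
      · refine le_of_mul_le_mul_right ?_ h0
        nlinarith [mul_le_mul_of_nonneg_left h1 h5]
    · have h1 := H (WithLp.toLp 2 fun b => WithLp.toLp 2 (0, h b • delta 0))
      simpa [inner_smul_right, norm_smul, norm_delta] using h1
  · rintro ⟨hR, hC⟩ x
    have h1 : ∑ a, ‖∑ b, ⟪star (v a b), (x b).fst⟫_ℂ‖ ^ 2 ≤ K ^ 2 * ∑ b, ‖(x b).fst‖ ^ 2 := by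
      let z : Fin n → ℂ := fun a => ∑ b, ⟪star (v a b), (x b).fst⟫_ℂ
      have h2 := hswap (fun a => (starRingEnd ℂ) (z a)) fun b => (x b).fst
      have h3 : ∑ a, (starRingEnd ℂ) (z a) * ∑ b, ⟪star (v a b), (x b).fst⟫_ℂ =
          ((∑ a, ‖z a‖ ^ 2 : ℝ) : ℂ) := by
        push_cast
        exact Finset.sum_congr rfl fun b _ => Complex.conj_mul' _
      rw [h3] at h2
      have h4 : ∑ a, ‖z a‖ ^ 2 ≤
          ∑ b, ‖∑ a, (starRingEnd ℂ) (z a) • v a b‖ * ‖(x b).fst‖ := by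
        calc ∑ a, ‖z a‖ ^ 2 = ‖((∑ a, ‖z a‖ ^ 2 : ℝ) : ℂ)‖ := by
              rw [Complex.norm_real, Real.norm_of_nonneg (by positivity)]
          _ ≤ _ := by
              rw [h2]
              refine (norm_sum_le _ _).trans (Finset.sum_le_sum fun b _ => ?_)
              exact (norm_inner_le_norm _ _).trans_eq (by rw [norm_star])
      have h5 := Finset.sum_mul_sq_le_sq_mul_sq Finset.univ
        (fun b => ‖∑ a, (starRingEnd ℂ) (z a) • v a b‖) fun b => ‖(x b).fst‖
      have h6 := hR fun a => (starRingEnd ℂ) (z a)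
      simp only [RCLike.norm_conj] at h6
      have h7 : 0 ≤ ∑ a, ‖z a‖ ^ 2 := by positivity
      have h8 : 0 ≤ ∑ b, ‖(x b).fst‖ ^ 2 := by positivity
      change ∑ a, ‖z a‖ ^ 2 ≤ _
      rcases h7.eq_or_lt with h0 | h0
      · rw [← h0]; positivity
      · refine le_of_mul_le_mul_right ?_ h0
        have h9 := mul_le_mul_of_nonneg_right h6 h8
        have h10 := pow_le_pow_left₀ h7 h4 2
        nlinarith
    refine (add_le_add h1 (hC _)).trans ?_
    rw [Finset.sum_add_distrib, mul_add]
    gcongr with b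
    exact (norm_inner_le_norm _ _).trans_eq (by rw [norm_delta, one_mul])

theorem norm_graphEmb {A : ell2 →L[ℂ] ell2} (hA : ‖A‖ ≤ 1) (ξ : ell2) : ‖graphEmb A ξ‖ = ‖ξ‖ := by
  apply le_antisymm
  · refine ContinuousLinearMap.opNorm_le_bound _ (norm_nonneg _) fun z => ?_
    rw [← pow_le_pow_iff_left₀ (norm_nonneg _) (by positivity) two_ne_zero, mul_pow,
      WithLp.prod_norm_sq_eq_of_L2, WithLp.prod_norm_sq_eq_of_L2 z, graphEmb_apply_fst,
      graphEmb_apply_snd, norm_smul, norm_smul, norm_delta, mul_one]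
    have h1 : ‖⟪star ξ, z.fst⟫_ℂ‖ ≤ ‖ξ‖ * ‖z.fst‖ :=
      (norm_inner_le_norm _ _).trans_eq (by rw [norm_star])
    have h2 : ‖⟪delta 0, z.snd⟫_ℂ‖ ≤ ‖z.snd‖ :=
      (norm_inner_le_norm _ _).trans_eq (by rw [norm_delta, one_mul])
    have h3 : ‖A ξ‖ ≤ ‖ξ‖ := (A.le_of_opNorm_le hA ξ).trans_eq (one_mul _)
    calc _ ≤ (‖ξ‖ * ‖z.fst‖) ^ 2 + (‖z.snd‖ * ‖ξ‖) ^ 2 := by gcongr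
      _ = _ := by ring
  · have h1 := (graphEmb A ξ).le_opNorm (WithLp.toLp 2 (star ξ, 0))
    have h2 : ‖(WithLp.toLp 2 (star ξ, 0) : ell2Sum)‖ = ‖ξ‖ := by
      rw [← pow_left_inj₀ (norm_nonneg _) (norm_nonneg _) two_ne_zero,
        WithLp.prod_norm_sq_eq_of_L2]
      simp
    have h3 : ‖ξ‖ ^ 2 = ‖graphEmb A ξ (WithLp.toLp 2 (star ξ, 0))‖ := by
      rw [← pow_left_inj₀ (by positivity) (norm_nonneg _) two_ne_zero,
        WithLp.prod_norm_sq_eq_of_L2, graphEmb_apply_fst, graphEmb_apply_snd]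
      simp [norm_smul, norm_delta]
    rw [h2, ← h3] at h1
    rcases (norm_nonneg ξ).eq_or_lt with h0 | h0
    · rw [← h0]; positivity
    · nlinarith

end Operators

theorem mass_le_sq_iff {E L : Type*} [NormedAddCommGroup E] [InnerProductSpace ℂ E]
    [NormedAddCommGroup L] [InnerProductSpace ℂ L] {n : ℕ} (B : E →L[ℂ] L) (η : Fin n → E) {K : ℝ}
    (hK : 0 ≤ K) : mass B η ≤ K ^ 2 ↔
      (∀ β : Fin n → ℂ, ‖∑ a, β a • η a‖ ^ 2 ≤ K ^ 2 * ∑ a, ‖β a‖ ^ 2) ∧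
        ∑ a, ‖B (η a)‖ ^ 2 ≤ K ^ 2 := by
  rw [mass, max_le_iff, pow_le_pow_iff_left₀ (norm_nonneg _) hK two_ne_zero, norm_synth_le_iff hK]

/-! ### From columns to completely bounded norms on subspaces of X(A). -/

section Subspaces

variable {A : ell2 →L[ℂ] ell2} {Y : ClosedSubmodule ℂ (ell2Sum →L[ℂ] ell2Sum)} {n : ℕ}

theorem mem_carrier {x : ell2} : x ∈ (carrier A Y).toSubmodule ↔ graphEmb A x ∈ Y.toSubmodule :=
  Iff.rfl

theorem norm_restr_le (hA : ‖A‖ ≤ 1) : ‖restr A Y‖ ≤ 1 :=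
  ContinuousLinearMap.opNorm_le_bound _ zero_le_one fun x => A.le_of_opNorm_le hA x

theorem isCompactOperator_restr (hA : IsCompactOperator A) : IsCompactOperator (restr A Y) :=
  hA.comp_clm _

/-- The matrix over `X(A)` attached to a matrix over the carrier of `Y`. -/
noncomputable def graphMatrix (A : ell2 →L[ℂ] ell2) (Y : ClosedSubmodule ℂ (ell2Sum →L[ℂ] ell2Sum))
    (v : Matrix (Fin n) (Fin n) (carrier A Y).toSubmodule) :
    Matrix (Fin n) (Fin n) (ell2Sum →L[ℂ] ell2Sum) :=
  v.map fun x => graphEmb A x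

theorem matNorm_graphMatrix_le_iff (v : Matrix (Fin n) (Fin n) (carrier A Y).toSubmodule) {K : ℝ}
    (hK : 0 ≤ K) : matNorm (graphMatrix A Y v) ≤ K ↔
      (∀ β : Fin n → ℂ, ∑ b, ‖∑ a, β a • v a b‖ ^ 2 ≤ K ^ 2 * ∑ a, ‖β a‖ ^ 2) ∧
      ∀ h : Fin n → ℂ, ∑ a, ‖restr A Y (∑ b, h b • v a b)‖ ^ 2 ≤ K ^ 2 * ∑ b, ‖h b‖ ^ 2 := by
  have := matNorm_graphEmb_le_iff A (v.map fun x => (x : ell2)) hK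
  simp only [Submodule.coe_norm, Submodule.coe_sum, Submodule.coe_smul]
  simpa [restr, graphMatrix, Matrix.map_map, Function.comp_def] using this

/-- This identifies `mass` with the operator-space norm. The size n + 1 guarantees that there is a
column 0. -/
theorem matNorm_column_sq (η : Fin (n + 1) → (carrier A Y).toSubmodule) :
    matNorm (graphMatrix A Y (Matrix.of fun a b => if b = 0 then η a else 0)) ^ 2 =
      mass (restr A Y) η := by
  have key : ∀ K : ℝ, 0 ≤ K →
      (matNorm (graphMatrix A Y (Matrix.of fun a b => if b = 0 then η a else 0)) ≤ K ↔
        mass (restr A Y) η ≤ K ^ 2) := fun K hK => by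
    rw [matNorm_graphMatrix_le_iff _ hK, mass_le_sq_iff _ _ hK]
    refine and_congr (forall_congr' fun β => ?_) ⟨fun H => ?_, fun H h => ?_⟩
    · rw [Finset.sum_eq_single 0]
      · simp
      · intro b _ hb
        simp [hb]
      · simp
    · have := H (Pi.single 0 1)
      rw [Finset.sum_eq_single (f := fun b => ‖(Pi.single 0 1 : Fin (n + 1) → ℂ) b‖ ^ 2) 0] at this
      · simpa using this
      · intro b _ hb
        simp [hb]
      · simp
    · have h0 : ‖h 0‖ ^ 2 ≤ ∑ b, ‖h b‖ ^ 2 :=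
        Finset.single_le_sum (f := fun b => ‖h b‖ ^ 2) (fun _ _ => by positivity)
          (Finset.mem_univ 0)
      calc ∑ a, ‖restr A Y (∑ b, h b • (Matrix.of fun a b => if b = 0 then η a else 0) a b)‖ ^ 2
          = ‖h 0‖ ^ 2 * ∑ a, ‖restr A Y (η a)‖ ^ 2 := by
            rw [Finset.mul_sum]
            simp [norm_smul, mul_pow]
        _ ≤ (∑ b, ‖h b‖ ^ 2) * K ^ 2 := by gcongr
        _ = _ := mul_comm _ _
  apply le_antisymm
  · have := (key _ (Real.sqrt_nonneg (mass (restr A Y) η))).2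
      (Real.sq_sqrt (mass_nonneg _ _)).ge
    calc _ ≤ √(mass (restr A Y) η) ^ 2 := pow_le_pow_left₀ (norm_nonneg _) this 2
      _ = _ := Real.sq_sqrt (mass_nonneg _ _)
  · exact (key _ (norm_nonneg _)).1 le_rfl

/-- Column estimates control all matrices: the row condition needs only ‖U‖ ≤ L, which is the case n
= 1, and for each h the column condition concerns the single column Σ_b h_b v_ab. -/
theorem matNorm_graphMatrix_map_le (hA : ‖A‖ ≤ 1)
    {U : (carrier A Y).toSubmodule →L[ℂ] (carrier A Y).toSubmodule} {L : ℝ} (hL : 0 ≤ L)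
    (hU : ∀ (n : ℕ) (η : Fin n → (carrier A Y).toSubmodule),
      mass (restr A Y) (fun a => U (η a)) ≤ L ^ 2 * mass (restr A Y) η)
    (v : Matrix (Fin n) (Fin n) (carrier A Y).toSubmodule) :
    matNorm (graphMatrix A Y (v.map U)) ≤ L * matNorm (graphMatrix A Y v) := by
  obtain ⟨hR, hC⟩ := (matNorm_graphMatrix_le_iff v (norm_nonneg _)).1 le_rfl
  set K := matNorm (graphMatrix A Y v) with hKdef
  have hK : 0 ≤ K := norm_nonneg _
  have hUn : ∀ x, ‖U x‖ ^ 2 ≤ L ^ 2 * ‖x‖ ^ 2 := fun x => by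
    have := hU 1 fun _ => x
    rwa [mass_single (norm_restr_le hA), mass_single (norm_restr_le hA)] at this
  rw [matNorm_graphMatrix_le_iff _ (by positivity)]
  simp only [Matrix.map_apply, ← map_smul, ← map_sum U]
  refine ⟨fun β => ?_, fun h => ?_⟩
  · calc _ ≤ ∑ b, L ^ 2 * ‖∑ a, β a • v a b‖ ^ 2 := Finset.sum_le_sum fun b _ => hUn _
      _ ≤ L ^ 2 * (K ^ 2 * ∑ a, ‖β a‖ ^ 2) := by
        rw [← Finset.mul_sum]
        gcongr
        exact hR β
      _ = _ := by ring
  · have hs : ‖synth fun a => ∑ b, h b • v a b‖ ^ 2 ≤ K ^ 2 * ∑ b, ‖h b‖ ^ 2 := by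
      have h0 : 0 ≤ K ^ 2 * ∑ b, ‖h b‖ ^ 2 := by positivity
      rw [← Real.sq_sqrt h0]
      gcongr
      rw [norm_synth_le_iff (Real.sqrt_nonneg _), Real.sq_sqrt h0]
      intro β
      have e : ∑ a, β a • ∑ b, h b • v a b = ∑ b, h b • ∑ a, β a • v a b := by
        simp only [Finset.smul_sum]
        rw [Finset.sum_comm]
        simp only [smul_comm (β _)]
      rw [e]
      calc _ ≤ (∑ b, ‖h b‖ * ‖∑ a, β a • v a b‖) ^ 2 := by
            gcongr
            exact (norm_sum_le _ _).trans_eq (by simp only [norm_smul])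
        _ ≤ (∑ b, ‖h b‖ ^ 2) * ∑ b, ‖∑ a, β a • v a b‖ ^ 2 :=
            Finset.sum_mul_sq_le_sq_mul_sq _ _ _
        _ ≤ (∑ b, ‖h b‖ ^ 2) * (K ^ 2 * ∑ a, ‖β a‖ ^ 2) := by
            gcongr
            exact hR β
        _ = _ := by ring
    calc _ ≤ mass (restr A Y) (fun a => U (∑ b, h b • v a b)) := le_max_right _ _
      _ ≤ L ^ 2 * mass (restr A Y) (fun a => ∑ b, h b • v a b) := hU n _
      _ ≤ L ^ 2 * (K ^ 2 * ∑ b, ‖h b‖ ^ 2) := by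
        gcongr
        exact max_le hs (hC h)
      _ = _ := by ring

theorem sum_tensor_graphEmb {ι : Type*} (s : Finset ι) (a : ι → Matrix (Fin n) (Fin n) ℂ)
    (f : ι → (carrier A Y).toSubmodule) :
    ∑ i ∈ s, tensor (a i) (graphEmb A (f i)) =
      graphMatrix A Y (Matrix.of fun r c => ∑ i ∈ s, a i r c • f i) := by
  ext1 r c
  simp [tensor, graphMatrix, Matrix.sum_apply, map_sum]

/-- The isometric identification of the carrier of `Y` with a subspace of `X(A)`. -/
noncomputable def graphIsometry (hA : ‖A‖ ≤ 1) (Y : ClosedSubmodule ℂ (ell2Sum →L[ℂ] ell2Sum)) :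
    (carrier A Y).toSubmodule →ₗᵢ[ℂ] (ell2Sum →L[ℂ] ell2Sum) where
  toLinearMap := (graphEmb A).toLinearMap ∘ₗ (carrier A Y).toSubmodule.subtype
  norm_map' x := norm_graphEmb hA x

theorem range_graphIsometry (hA : ‖A‖ ≤ 1) (hY : Y.toSubmodule ≤ spaceX A) :
    Set.range (graphIsometry hA Y) = (Y.toSubmodule : Set (ell2Sum →L[ℂ] ell2Sum)) := by
  ext y
  constructor
  · rintro ⟨x, rfl⟩
    exact x.2
  · intro hy
    obtain ⟨x, rfl⟩ := hY hy
    exact ⟨⟨x, hy⟩, rfl⟩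

theorem closedSpan_eq_iff (hA : ‖A‖ ≤ 1) (hY : Y.toSubmodule ≤ spaceX A) {ι : Type*}
    (f : ι → (carrier A Y).toSubmodule) :
    closedSpan (fun i => graphEmb A (f i)) = Y.toSubmodule ↔
      (Submodule.span ℂ (Set.range f)).topologicalClosure = ⊤ := by
  let J := graphIsometry hA Y
  have h1 : (closedSpan (fun i => graphEmb A (f i)) : Set (ell2Sum →L[ℂ] ell2Sum)) =
      J '' ((Submodule.span ℂ (Set.range f)).topologicalClosure : Set _) := by
    rw [closedSpan, Submodule.topologicalClosure_coe, Submodule.topologicalClosure_coe,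
      ← J.isometry.isClosedEmbedding.closure_image_eq]
    congr 1
    rw [show Set.range (fun i => graphEmb A (f i)) = J '' Set.range f by
      rw [← Set.range_comp]; rfl]
    exact congrArg _ (Submodule.map_span J.toLinearMap _).symm
  rw [← SetLike.coe_set_eq, h1, ← range_graphIsometry hA hY,
    ← Set.image_univ (f := graphIsometry hA Y),
    J.injective.image_injective.eq_iff, ← Submodule.top_coe (R := ℂ), SetLike.coe_set_eq]

theorem cbNorm_le {X Z : Submodule ℂ (ell2Sum →L[ℂ] ell2Sum)} (hA : ‖A‖ ≤ 1)
    {U : (carrier A Y).toSubmodule →L[ℂ] (carrier A Y).toSubmodule} {L : ℝ} (hL : 0 ≤ L)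
    (hU : ∀ (n : ℕ) (η : Fin n → (carrier A Y).toSubmodule),
      mass (restr A Y) (fun a => U (η a)) ≤ L ^ 2 * mass (restr A Y) η)
    (u : X →ₗ[ℂ] Z) (hu : ∀ x : X, ∃ w : (carrier A Y).toSubmodule,
      (x : ell2Sum →L[ℂ] ell2Sum) = graphEmb A w ∧
        (u x : ell2Sum →L[ℂ] ell2Sum) = graphEmb A (U w)) :
    cbNorm u ≤ ENNReal.ofReal L := by
  choose w hw hw' using hu
  refine iSup_le fun n => iSup_le fun v => iSup_le fun hv => ENNReal.ofReal_le_ofReal ?_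
  have e1 : (v.map fun x => (x : ell2Sum →L[ℂ] ell2Sum)) = graphMatrix A Y (v.map w) := by
    ext1 a b
    exact hw _
  have e2 : (v.map fun x => (u x : ell2Sum →L[ℂ] ell2Sum)) =
      graphMatrix A Y ((v.map w).map U) := by
    ext1 a b
    exact hw' _
  rw [e2]
  rw [e1] at hv
  exact (matNorm_graphMatrix_map_le hA hL hU _).trans (mul_le_of_le_one_right hL hv)

/-- The sequence consists of the projections of the unit vectors; it serves to prove that bases are
countable. -/
theorem exists_separating_sequence (A : ell2 →L[ℂ] ell2)
    (Y : ClosedSubmodule ℂ (ell2Sum →L[ℂ] ell2Sum)) :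
    ∃ δ : ℕ → (carrier A Y).toSubmodule, ∀ x, (∀ m, ⟪δ m, x⟫_ℂ = 0) → x = 0 := by
  refine ⟨fun m => (carrier A Y).toSubmodule.subtypeL.adjoint (delta m), fun x hx => ?_⟩
  ext m
  have := hx m
  rw [ContinuousLinearMap.adjoint_inner_left, inner_delta] at this
  exact this

/-- Unconditionality is applied to coefficient matrices supported in column 0. For n = 0 both masses
vanish. -/
theorem IsNormalizedCUBasis.isColumnUnconditional (hA : ‖A‖ ≤ 1)
    (hY : Y.toSubmodule ≤ spaceX A) {ι : Type*} {C : ℝ} {f : ι → (carrier A Y).toSubmodule}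
    (h : IsNormalizedCUBasis C Y.toSubmodule fun i => graphEmb A (f i)) :
    IsColumnUnconditional C (restr A Y) f where
  one_le := h.unconditional.1
  norm_eq i := (norm_graphEmb hA _).symm.trans (h.normalized i)
  dense := (closedSpan_eq_iff hA hY f).1 h.span_eq
  mass_le n s x l hl := by
    rcases n with _ | n
    · have h0 : ∀ η : Fin 0 → (carrier A Y).toSubmodule, mass (restr A Y) η = 0 := fun η => by
        simp [mass, synth]
      rw [h0, h0, mul_zero]
    · let a : ι → Matrix (Fin (n + 1)) (Fin (n + 1)) ℂ := fun i =>
        Matrix.of fun r c => if c = 0 then x r i else 0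
      have e : ∀ y : Fin (n + 1) → ι → ℂ, graphMatrix A Y (Matrix.of fun r c =>
            if c = 0 then ∑ i ∈ s, y r i • f i else 0) =
          ∑ i ∈ s, tensor (Matrix.of fun r c => if c = 0 then y r i else 0)
            (graphEmb A (f i)) := fun y => by
        rw [sum_tensor_graphEmb]
        congr 1
        ext1 r c
        by_cases hc : c = 0 <;> simp [hc]
      have key := h.unconditional.2 (n + 1) s a l hl
      have e' : ∀ i, l i • tensor (a i) (graphEmb A (f i)) =
          tensor (Matrix.of fun r c => if c = 0 then l i * x r i else 0) (graphEmb A (f i)) :=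
        fun i => by
          ext1 r c
          by_cases hc : c = 0 <;> simp [tensor, a, hc, mul_smul]
      simp only [e'] at key
      rw [← e, ← e] at key
      rw [← matNorm_column_sq, ← matNorm_column_sq, ← mul_pow]
      exact pow_le_pow_left₀ (norm_nonneg _) key 2

end Subspaces

/-! ### The modulus, spectral theorem and diagonal contractions. -/

section Eigenbases

variable {κ E L : Type*} [NormedAddCommGroup E] [InnerProductSpace ℂ E] [CompleteSpace E]
  [NormedAddCommGroup L] [InnerProductSpace ℂ L] [CompleteSpace L]

theorem adjoint_comp_self_nonneg (T : E →L[ℂ] L) : 0 ≤ T.adjoint ∘L T :=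
  (ContinuousLinearMap.nonneg_iff_isPositive _).2 T.isPositive_adjoint_comp_self

theorem modulus_modulus_apply (T : E →L[ℂ] L) (x : E) :
    modulus T (modulus T x) = T.adjoint (T x) := by
  have h := CFC.sqrt_mul_sqrt_self (T.adjoint ∘L T) (adjoint_comp_self_nonneg T)
  exact congrArg (fun S : E →L[ℂ] E => S x) h

theorem modulus_isPositive (T : E →L[ℂ] L) : (modulus T).IsPositive :=
  (ContinuousLinearMap.nonneg_iff_isPositive _).1 (CFC.sqrt_nonneg _)

theorem adjoint_apply_of_modulus_eigen {T : E →L[ℂ] L} {x : E} {s : ℝ}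
    (h : modulus T x = (s : ℂ) • x) : T.adjoint (T x) = ((s : ℂ) * s) • x := by
  rw [← modulus_modulus_apply, h, map_smul, h, smul_smul]

/-- With t = ‖Tx‖/‖x‖, the vector y = |T|x - tx satisfies |T|y = -ty, so positivity forces y = 0
when t > 0. If t = 0, then ‖|T|x‖² = ⟨x, T*Tx⟩ = 0. -/
theorem modulus_apply_of_eigen {T : E →L[ℂ] L} {x : E} {μ : ℂ}
    (h : T.adjoint (T x) = μ • x) : ∃ s : ℝ, modulus T x = (s : ℂ) • x := by
  rcases eq_or_ne x 0 with rfl | hx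
  · exact ⟨0, by simp⟩
  have hxx : (0 : ℝ) < ‖x‖ ^ 2 := by positivity
  have h1 : ((‖T x‖ ^ 2 : ℝ) : ℂ) = μ * ((‖x‖ ^ 2 : ℝ) : ℂ) := by
    have h2 : ⟪x, T.adjoint (T x)⟫_ℂ = ⟪x, μ • x⟫_ℂ := by rw [h]
    rw [ContinuousLinearMap.adjoint_inner_right, inner_smul_right, inner_self_eq_norm_sq_to_K,
      inner_self_eq_norm_sq_to_K] at h2
    exact_mod_cast h2
  obtain ⟨t, ht, rfl⟩ : ∃ t : ℝ, 0 ≤ t ∧ μ = ((t ^ 2 : ℝ) : ℂ) := by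
    refine ⟨√(‖T x‖ ^ 2 / ‖x‖ ^ 2), Real.sqrt_nonneg _, ?_⟩
    rw [Real.sq_sqrt (by positivity), Complex.ofReal_div, h1, mul_div_cancel_right₀]
    exact_mod_cast hxx.ne'
  have hpos := modulus_isPositive T
  refine ⟨t, sub_eq_zero.1 ?_⟩
  set y := modulus T x - (t : ℂ) • x with hy
  have hQy : modulus T y = -(t : ℂ) • y := by
    rw [hy, map_sub, map_smul, modulus_modulus_apply, h, smul_sub, smul_smul, neg_smul, neg_mul,
      neg_smul]
    push_cast
    rw [sq]
    abel
  have h3 : 0 ≤ -(t * ‖y‖ ^ 2) := by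
    have := hpos.re_inner_nonneg_right y
    rw [hQy, inner_smul_right, inner_self_eq_norm_sq_to_K] at this
    simpa [← Complex.ofReal_pow] using this
  rcases ht.eq_or_lt with h0 | h0
  · have hy' : y = modulus T x := by rw [hy, ← h0]; simp
    have h4 : ⟪modulus T x, modulus T x⟫_ℂ = 0 := by
      rw [← hpos.isSelfAdjoint.adjoint_eq, ContinuousLinearMap.adjoint_inner_left,
        hpos.isSelfAdjoint.adjoint_eq, modulus_modulus_apply, h, ← h0]
      simp
    rw [hy']
    exact inner_self_eq_zero.1 h4
  · have h5 : ‖y‖ ^ 2 ≤ 0 := by nlinarith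
    exact norm_eq_zero.1 (pow_eq_zero_iff two_ne_zero |>.1 (le_antisymm h5 (by positivity)))

/-- Hilbert bases of all eigenspaces, the kernel included, are put together; compactness makes their
joint orthogonal complement trivial. -/
theorem exists_orthonormal_eigenvectors {E : Type} [NormedAddCommGroup E] [InnerProductSpace ℂ E]
    [CompleteSpace E] {T : E →L[ℂ] E} (hT : IsCompactOperator T) (hs : T.IsSymmetric) :
    ∃ (κ : Type) (ξ : κ → E), Orthonormal ℂ ξ ∧
      (Submodule.span ℂ (Set.range ξ)).topologicalClosure = ⊤ ∧
      ∀ k, ∃ μ : ℂ, T (ξ k) = μ • ξ k := by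
  let V : ℂ → Submodule ℂ E := fun μ => Module.End.eigenspace (T : Module.End ℂ E) μ
  have hVc : ∀ μ, IsClosed (V μ : Set E) := fun μ => by
    have : (V μ : Set E) = {x | T x = μ • x} := by
      ext x
      exact Module.End.mem_eigenspace_iff
    rw [this]
    exact isClosed_eq T.continuous (continuous_const_smul μ)
  have : ∀ μ, CompleteSpace (V μ) := fun μ => (hVc μ).completeSpace_coe
  choose w b hb using fun μ => exists_hilbertBasis ℂ (V μ)
  let ξ : (Σ μ, w μ) → E := fun k => (b k.1 k.2 : V k.1)
  have hξ : Orthonormal ℂ ξ :=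
    hs.orthogonalFamily_eigenspaces.orthonormal_sigma_orthonormal fun μ => (b μ).orthonormal
  refine ⟨Σ μ, w μ, ξ, hξ, ?_, fun k => ⟨k.1, Module.End.mem_eigenspace_iff.1 (b k.1 k.2).2⟩⟩
  rw [Submodule.topologicalClosure_eq_top_iff, Submodule.eq_bot_iff]
  intro x hx
  have hbot := ContinuousLinearMap.orthogonalComplement_iSup_eigenspaces_eq_bot hT hs
  rw [← Submodule.mem_bot ℂ, ← hbot, Submodule.mem_orthogonal]
  intro y hy
  induction hy using Submodule.iSup_induction' with
  | zero => simp
  | add y z _ _ h1 h2 => rw [inner_add_left, h1, h2, add_zero]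
  | mem μ y hy =>
    have hsum := (b μ).hasSum_repr ⟨y, hy⟩
    have h2 := (hsum.mapL ((innerSL ℂ x) ∘L (V μ).subtypeL))
    have h3 : ∀ i, ((innerSL ℂ x) ∘L (V μ).subtypeL) ((b μ).repr ⟨y, hy⟩ i • b μ i) = 0 := by
      intro i
      have : ⟪x, ξ ⟨μ, i⟩⟫_ℂ = 0 :=
        Submodule.inner_left_of_mem_orthogonal
          (Submodule.subset_span (Set.mem_range_self (⟨μ, i⟩ : Σ μ, w μ))) hx
      rw [map_smul]
      exact (congrArg _ this).trans (smul_zero _)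
    simp only [h3] at h2
    have h4 : ⟪x, y⟫_ℂ = 0 := h2.unique hasSum_zero
    rw [← inner_conj_symm, h4, map_zero]

/-- By Parseval, both for the identity and for B, a diagonal contraction only shrinks each
coordinate's contribution to either half of the mass. -/
theorem mass_diagonal_le {B : E →L[ℂ] L} (b : HilbertBasis κ ℂ E)
    (hb : ∀ k, ∃ s : ℂ, B.adjoint (B (b k)) = s • b k) {l : κ → ℂ} (hl : ∀ k, ‖l k‖ ≤ 1) :
    ∃ U : E →L[ℂ] E, (∀ k, U (b k) = l k • b k) ∧
      ∀ (n : ℕ) (η : Fin n → E), mass B (fun a => U (η a)) ≤ 1 ^ 2 * mass B η := by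
  classical
  let U : E →L[ℂ] E := (b.repr.symm.toContinuousLinearEquiv : ℓ²(κ, ℂ) →L[ℂ] E) ∘L
    diagOp l hl ∘L (b.repr.toContinuousLinearEquiv : E →L[ℂ] ℓ²(κ, ℂ))
  have hrepr : ∀ x, b.repr (U x) = diagOp l hl (b.repr x) := fun x => by simp [U]
  have hin : ∀ x k, ⟪b k, U x⟫_ℂ = l k * ⟪b k, x⟫_ℂ := fun x k => by
    rw [← b.repr_apply_apply, hrepr, diagOp_apply, b.repr_apply_apply]
  refine ⟨U, fun k => b.repr.injective ?_, fun n η => ?_⟩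
  · ext j
    rw [hrepr, diagOp_apply, map_smul, lp.coeFn_smul, Pi.smul_apply, b.repr_self, lp.single_apply,
      smul_eq_mul]
    rcases eq_or_ne j k with rfl | hjk
    · rfl
    · simp [Pi.single_eq_of_ne hjk]
  · rw [one_pow, one_mul]
    refine max_le_max ?_ (Finset.sum_le_sum fun a _ => ?_)
    · gcongr
      refine (norm_synth_comp_le U η).trans (mul_le_of_le_one_left (norm_nonneg _) ?_)
      refine ContinuousLinearMap.opNorm_le_bound _ zero_le_one fun x => ?_
      rw [← b.repr.norm_map, hrepr, ← b.repr.norm_map x]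
      exact (diagOp l hl).le_of_opNorm_le (norm_diagOp_le _ _) _
    · refine hasSum_le (fun k => ?_) (hasSum_norm_sq_map b hb _) (hasSum_norm_sq_map b hb _)
      rw [hin, norm_mul]
      gcongr
      exact mul_le_of_le_one_left (norm_nonneg _) (hl k)

end Eigenbases

/-! ### Canonical bases and the theorem. -/

section CanonicalBases

variable {A : ell2 →L[ℂ] ell2} {Y : ClosedSubmodule ℂ (ell2Sum →L[ℂ] ell2Sum)}

theorem exists_isCanonicalBasis (hA : IsCompactOperator A) :
    ∃ (κ : Type) (e : κ → (ell2Sum →L[ℂ] ell2Sum)), IsCanonicalBasis A Y e := by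
  let B := restr A Y
  have hB : IsCompactOperator (B.adjoint ∘L B) := (isCompactOperator_restr hA).clm_comp B.adjoint
  obtain ⟨κ, ξ, h1, h2, h3⟩ := exists_orthonormal_eigenvectors hB
    B.isPositive_adjoint_comp_self.isSymmetric
  exact ⟨κ, fun k => graphEmb A (ξ k), ξ, h1, h2,
    fun k => modulus_apply_of_eigen (h3 k).choose_spec, fun _ => rfl⟩

theorem IsCanonicalBasis.exists_hilbertBasis {κ : Type*} {e : κ → (ell2Sum →L[ℂ] ell2Sum)}
    (he : IsCanonicalBasis A Y e) : ∃ b : HilbertBasis κ ℂ (carrier A Y).toSubmodule,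
      (e = fun k => graphEmb A (b k)) ∧
        ∀ k, ∃ s : ℂ, (restr A Y).adjoint (restr A Y (b k)) = s • b k := by
  obtain ⟨ξ, h1, h2, h3, h4⟩ := he
  refine ⟨HilbertBasis.mk h1 h2.ge, funext fun k => ?_, fun k => ?_⟩
  · rw [HilbertBasis.coe_mk, h4]
  · rw [HilbertBasis.coe_mk]
    obtain ⟨s, hs⟩ := h3 k
    exact ⟨_, adjoint_apply_of_modulus_eigen hs⟩

theorem IsCanonicalBasis.isNormalizedCUBasis (hA : ‖A‖ ≤ 1) (hY : Y.toSubmodule ≤ spaceX A)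
    {κ : Type*} {e : κ → (ell2Sum →L[ℂ] ell2Sum)} (he : IsCanonicalBasis A Y e) :
    IsNormalizedCUBasis 1 Y.toSubmodule e := by
  obtain ⟨b, rfl, hb⟩ := he.exists_hilbertBasis
  refine ⟨fun k => (norm_graphEmb hA _).trans (b.orthonormal.1 k), ⟨le_rfl, fun n s a l hl => ?_⟩,
    (closedSpan_eq_iff hA hY b).2 b.dense_span⟩
  obtain ⟨U, hU, hmass⟩ := mass_diagonal_le b hb hl
  have key := matNorm_graphMatrix_map_le hA zero_le_one hmass
    (Matrix.of fun r c => ∑ i ∈ s, a i r c • b i)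
  have e1 : ∀ i, l i • tensor (a i) (graphEmb A (b i)) =
      tensor (a i) (graphEmb A ((l i • b i : (carrier A Y).toSubmodule) : ell2)) := fun i => by
    ext1 r c
    change l i • a i r c • graphEmb A (b i) = a i r c • graphEmb A (l i • (b i : ell2))
    rw [map_smul, smul_comm]
  have e2 : (Matrix.of fun r c => ∑ i ∈ s, a i r c • b i).map U =
      Matrix.of fun r c => ∑ i ∈ s, a i r c • (l i • b i) := by
    ext1 r c
    simp [map_sum, hU]
  rw [e2] at key
  simp only [e1]
  rw [sum_tensor_graphEmb s a b, sum_tensor_graphEmb s a fun i => l i • b i]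
  exact key

theorem cEquivalent_of_mass_le (hA : ‖A‖ ≤ 1) (hY : Y.toSubmodule ≤ spaceX A) {ι : Type*}
    {f h : ι → (carrier A Y).toSubmodule}
    (hf : closedSpan (fun i => graphEmb A (f i)) = Y.toSubmodule)
    (hh : closedSpan (fun i => graphEmb A (h i)) = Y.toSubmodule)
    (U : (carrier A Y).toSubmodule ≃L[ℂ] (carrier A Y).toSubmodule) (hU : ∀ i, U (f i) = h i)
    {K L c : ℝ} (hK : 0 ≤ K) (hL : 0 ≤ L) (hc : K * L ≤ c)
    (h1 : ∀ (n : ℕ) (η : Fin n → (carrier A Y).toSubmodule),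
      mass (restr A Y) (fun a => U (η a)) ≤ K ^ 2 * mass (restr A Y) η)
    (h2 : ∀ (n : ℕ) (η : Fin n → (carrier A Y).toSubmodule),
      mass (restr A Y) (fun a => U.symm (η a)) ≤ L ^ 2 * mass (restr A Y) η) :
    CEquivalent c (fun i => graphEmb A (f i)) fun i => graphEmb A (h i) := by
  let J : (carrier A Y).toSubmodule ≃ₗ[ℂ] Y.toSubmodule := LinearEquiv.ofBijective
    ((graphEmb A).toLinearMap.restrict (p := (carrier A Y).toSubmodule) (q := Y.toSubmodule)
      fun _ hx => hx)
    ⟨fun x y hxy => (graphIsometry hA Y).injective (congrArg Subtype.val hxy), fun y => by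
      obtain ⟨x, hx⟩ := hY y.2
      exact ⟨⟨x, mem_carrier.2 (hx ▸ y.2)⟩, Subtype.ext hx⟩⟩
  have hJ : ∀ x, (J x : ell2Sum →L[ℂ] ell2Sum) = graphEmb A x := fun _ => rfl
  let Jf := J.trans (LinearEquiv.ofEq _ _ hf.symm)
  let Jh := J.trans (LinearEquiv.ofEq _ _ hh.symm)
  have hJf : ∀ x, (Jf x : ell2Sum →L[ℂ] ell2Sum) = graphEmb A x := fun _ => rfl
  have hJh : ∀ x, (Jh x : ell2Sum →L[ℂ] ell2Sum) = graphEmb A x := fun _ => rfl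
  let u := Jf.symm.trans (U.toLinearEquiv.trans Jh)
  have hu : ∀ x, u (Jf x) = Jh (U x) := fun x => by simp [u]
  have hu' : ∀ x, u.symm (Jh x) = Jf (U.symm x) := fun x => by simp [u]
  refine ⟨u, fun i => ?_, ?_⟩
  · have e : (⟨graphEmb A (f i), mem_closedSpan _ i⟩ :
        closedSpan fun i => graphEmb A (f i)) = Jf (f i) := rfl
    rw [e, hu, hJh, hU]
  · have hu1 : cbNorm u.toLinearMap ≤ ENNReal.ofReal K := by
      refine cbNorm_le (U := U.toContinuousLinearMap) hA hK (fun n η => h1 n η) u.toLinearMap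
        fun x => ?_
      obtain ⟨w, rfl⟩ := Jf.surjective x
      exact ⟨w, hJf w, (congrArg Subtype.val (hu w)).trans (hJh _)⟩
    have hu2 : cbNorm u.symm.toLinearMap ≤ ENNReal.ofReal L := by
      refine cbNorm_le (U := U.symm.toContinuousLinearMap) hA hL (fun n η => h2 n η)
        u.symm.toLinearMap fun x => ?_
      obtain ⟨w, rfl⟩ := Jh.surjective x
      exact ⟨w, hJh w, (congrArg Subtype.val (hu' w)).trans (hJf _)⟩
    refine (mul_le_mul' hu1 hu2).trans ?_
    rw [← ENNReal.ofReal_mul hK]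
    exact ENNReal.ofReal_le_ofReal hc

end CanonicalBases

end RowCol

end

theorem mainTheorem4 (A : RowCol.ell2 →L[ℂ] RowCol.ell2) (hA : A ∈ RowCol.classC)
    (Y : ClosedSubmodule ℂ (RowCol.ell2Sum →L[ℂ] RowCol.ell2Sum))
    (hY : Y.toSubmodule ≤ RowCol.spaceX A) :
    (∃ (κ : Type) (e : κ → (RowCol.ell2Sum →L[ℂ] RowCol.ell2Sum)),
      RowCol.IsCanonicalBasis A Y e) ∧
    ∀ (κ : Type*) (e : κ → (RowCol.ell2Sum →L[ℂ] RowCol.ell2Sum)),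
      RowCol.IsCanonicalBasis A Y e →
        RowCol.IsNormalizedCUBasis 1 Y.toSubmodule e ∧
        ∀ (ι : Type*) (g : ι → (RowCol.ell2Sum →L[ℂ] RowCol.ell2Sum)) (C : ℝ),
          RowCol.IsNormalizedCUBasis C Y.toSubmodule g →
            RowCol.CEquivalentUpToPerm (16 * C ^ 11) g e := by
  obtain ⟨hc, hA1, -⟩ := hA
  refine ⟨RowCol.exists_isCanonicalBasis hc, fun κ e he =>
    ⟨he.isNormalizedCUBasis hA1 hY, fun ι g C hg => ?_⟩⟩
  obtain ⟨b, rfl, hb⟩ := he.exists_hilbertBasis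
  have hgY : ∀ i, ∃ x : (RowCol.carrier A Y).toSubmodule, RowCol.graphEmb A x = g i := fun i => by
    have hi : g i ∈ Y.toSubmodule := hg.span_eq ▸ RowCol.mem_closedSpan g i
    obtain ⟨x, hx⟩ := hY hi
    exact ⟨⟨x, RowCol.mem_carrier.2 (hx ▸ hi)⟩, hx⟩
  choose f hf using hgY
  obtain rfl : (fun i => RowCol.graphEmb A (f i)) = g := funext hf
  have hcol := hg.isColumnUnconditional hA1 hY
  obtain ⟨δ, hδ⟩ := RowCol.exists_separating_sequence A Y
  obtain ⟨π, U, hU, h1, h2⟩ := hcol.exists_equiv_mass_le (RowCol.norm_restr_le hA1)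
    (RowCol.isCompactOperator_restr hc) hδ b hb
  have hC : 1 ≤ C := hcol.one_le
  have hC0 : 0 ≤ C := zero_le_one.trans hC
  have hC7 : C ^ 7 ≤ C ^ 11 := pow_le_pow_right₀ hC (by norm_num)
  have hC11 : 0 ≤ C ^ 11 := by positivity
  obtain ⟨b', hb'⟩ := RowCol.exists_hilbertBasis_reindex b π
  refine ⟨π, RowCol.cEquivalent_of_mass_le hA1 hY (h := fun i => b (π i)) hg.span_eq
    ((RowCol.closedSpan_eq_iff hA1 hY _).2 ?_) U hU (K := 2 * C ^ 4) (L := 2 * C ^ 3)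
    (by positivity) (by positivity) ?_ h1 h2⟩
  · simpa only [← hb'] using b'.dense_span
  -- The product of the two constants is 4C⁷, and C⁷ ≤ C¹¹ because C ≥ 1.
  · nlinarith
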